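/- Let $n\ge 2$ and let $A=(a^i_j)$ (row $j$, column $i$) be a lower triangular unipotent integer $n\times n$ matrix. Let $X=X_n(A)=(\mathbb C^2\setminus\{0\})^n/(\mathbb C^\times)^n$ be the associated stage $n$ Bott manifold, where $t=(t_1,\dots,t_n)$ acts by $t\cdot(z_i,w_i)_i=\bigl(t_iz_i,\ \prod_{k}t_k^{a^k_i}\,w_i\bigr)_i$. Let $e_1,\dots,e_n$ be the standard basis of $\mathbb Z^n$ and $u_i=-\sum_j a^i_j e_j$; write $v_{2i-1}=u_i$, $v_{2i}=e_i$. The fan $\Sigma$ of $X$ consists of the cones generated by those subsets of $\{v_1,\dots,v_{2n}\}$ which contain none of the pairs $\{u_i,e_i\}$. For $a=(a_1,\dots,a_{2n})\in\mathbb R^{2n}$ put $P_a=\{x\in\mathbb R^n:\langle x,v_i\rangle\ge -a_i,\ 1\le i\le 2n\}$; the class $\sum_i a_i[D_i]$ of the torus invariant divisors $D_i$ is Kähler if its support function is strictly convex on $\Sigma$ (so that $P_a$ is its moment polytope, with normal fan $\Sigma$). For $P=P_a$ with Kähler class and a coordinate function $x_i$ put $$F_{X_P}(x_i)=\mathrm{Vol}(P)\int_{\partial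 P}x_i\,d\sigma-\mathrm{Vol}(\partial P)\int_P x_i\,dv,$$ where $dv$ is Lebesgue measure and, on the facet $\ell_j=\langle x,v_j\rangle+a_j=0$, $dv=\pm d\sigma\wedge d\ell_j$. The same notation is used in dimension $n-1$. Fix $a_1,\dots,a_{2n-2}\in\mathbb R$ and for $s>0$ let $P_{[0,s]}=\{x:\langle x,v_i\rangle\ge -a_i\ (1\le i\le 2n-2),\ 0\le x_n\le s\}$. Assume that $P_{[0,s]}$ is the moment polytope of a Kähler class on $X$ for at least one $s$, and that for every $s>0$ for which it is, the Futaki invariant of $v=-x_n\partial/\partial x_n$ vanishes, i.e. $F_{X_{P_{[0,s]}}}(x_n)=0$. Let $\widetilde A$ be $A$ with its last row and column deleted, let $X'=X_{n-1}(\widetilde A)$ with fan $\Sigma'$, and let $Q\subset\mathbb R^{n-1}$ be the polytope given by $\Sigma'$ and $a_1,\dots,a_{2n-2}$. Then: 1. $P_{[0,s]}=Q\times[0,s]$ for every $s>0$, and $Q$ is the moment polytope of a Kähler class on $X'$. 2. $\Sigma$ is the product of $\Sigma'$ and the fan of $\mathbb P^1$, and $X\cong X'\times\mathbb P^1$ as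 complex manifolds. 3. The primitive collections of $\Sigma'$ are, under $\mathbb Z^{n-1}=\mathbb Z^{n-1}\times\{0\}\subset\mathbb Z^n$, exactly $\{v_1,v_2\},\{v_3,v_4\},\dots,\{v_{2n-3},v_{2n-2}\}$. 4. $F_{X_{P_{[0,s]}}}(x_i)=s^2F_{X'_Q}(x_i)$ for all $s>0$ and $1\le i\le n-1$. 5. If $F_{X_P}(x_i)=0$ for all $i\le n$ and the moment polytopes $P$ of all Kähler classes on $X$, then $F_{X'_{Q'}}(x_i)=0$ for all $i\le n-1$ and the moment polytopes $Q'$ of all Kähler classes on $X'$. -/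

import Mathlib

open scoped Manifold ContDiff

noncomputable section

/-! ### Bott matrices, the rays of the fan, and the fan -/

/-- A lower triangular unipotent integer matrix: `a j i` is the entry in row `j`, column `i`
(written `a_j^i`), it vanishes for `j < i` and equals `1` for `j = i`. -/
structure BottMatrix (n : ℕ) where
  a : Matrix (Fin n) (Fin n) ℤ
  diag : ∀ i, a i i = 1
  upper : ∀ j i, j < i → a j i = 0

namespace BottMatrix

/-- The upper left block obtained by deleting the last row and the last column. -/
def truncate {n : ℕ} (A : BottMatrix (n + 1)) : BottMatrix n where
  a := A.a.submatrix Fin.castSucc Fin.castSucc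
  diag _ := A.diag _
  upper _ _ h := A.upper _ _ (Fin.castSucc_lt_castSucc_iff.mpr h)

/-- The identity matrix of size one, the matrix of the projective line. -/
def one : BottMatrix 1 where
  a := 1
  diag _ := by simp
  upper _ _ h := by simp [h.ne]

/-- The ray generators: `A.ray i 0 = u_i = - ∑ j, a_j^i e_j` and `A.ray i 1 = e_i`. -/
def ray {n : ℕ} (A : BottMatrix n) (i : Fin n) (δ : Fin 2) : Fin n → ℤ :=
  if δ = 0 then fun j => - A.a j i else Pi.single i 1

end BottMatrix

/-- The pointed cone in `ℝⁿ` generated by a set of integer vectors. -/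
def latticeCone {n : ℕ} (R : Set (Fin n → ℤ)) : PointedCone ℝ (Fin n → ℝ) :=
  PointedCone.hull ℝ ((fun v : Fin n → ℤ => fun j => (v j : ℝ)) '' R)

/-- The fan of the Bott manifold: the cones generated by those sets of ray generators which
contain at most one of `u_i`, `e_i` for every `i`, that is, the cones over the faces of a cross
polytope. A set of rays is given by a subset `S` of the index set and a choice `c i` of one of the
two generators for each `i ∈ S`. -/
def BottMatrix.fan {n : ℕ} (A : BottMatrix n) : Set (PointedCone ℝ (Fin n → ℝ)) :=
  {σ | ∃ (S : Set (Fin n)) (c : Fin n → Fin 2), σ = latticeCone ((fun i => A.ray i (c i)) '' S)}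

/-- A lattice vector is primitive if it is not a proper multiple of a lattice vector
(in particular it is nonzero). -/
def IsPrimitiveVector {n : ℕ} (v : Fin n → ℤ) : Prop :=
  ∀ (k : ℤ) (w : Fin n → ℤ), v = k • w → IsUnit k

/-- The set `G_Σ` of primitive generators of the rays of a fan. -/
def fanGenerators {n : ℕ} (F : Set (PointedCone ℝ (Fin n → ℝ))) : Set (Fin n → ℤ) :=
  {v | IsPrimitiveVector v ∧ latticeCone {v} ∈ F}

/-- The set `PC(Σ)` of primitive collections of a fan. -/
def primitiveCollections {n : ℕ} (F : Set (PointedCone ℝ (Fin n → ℝ))) :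
    Set (Set (Fin n → ℤ)) :=
  {R | R.Nonempty ∧ R ⊆ fanGenerators F ∧ latticeCone R ∉ F ∧
    ∀ x ∈ R, latticeCone (R \ {x}) ∈ F}

/-- The product of a fan in `ℝⁿ` and a fan in `ℝ`: the cones `σ × ρ` in `ℝⁿ × ℝ = ℝⁿ⁺¹`. -/
def fanProd {n : ℕ} (F : Set (PointedCone ℝ (Fin n → ℝ))) (G : Set (PointedCone ℝ (Fin 1 → ℝ))) :
    Set (PointedCone ℝ (Fin (n + 1) → ℝ)) :=
  {τ | ∃ σ ∈ F, ∃ ρ ∈ G, ∀ x : Fin (n + 1) → ℝ,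
    x ∈ τ ↔ (fun i : Fin n => x i.castSucc) ∈ σ ∧ (fun _ : Fin 1 => x (Fin.last n)) ∈ ρ}

/-! ### Moment polytopes, Kähler classes and the toric Futaki invariant -/

namespace BottMatrix

/-- The pairing of a point of `M_ℝ = ℝⁿ` with a ray generator. -/
def pairing {n : ℕ} (A : BottMatrix n) (x : Fin n → ℝ) (i : Fin n) (δ : Fin 2) : ℝ :=
  ∑ j, x j * (A.ray i δ j : ℝ)

/-- The polytope `{x | ⟨x, v⟩ ≥ -a_v for every ray generator v}` of the real divisor
`∑ a_v D_v`. -/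
def polytope {n : ℕ} (A : BottMatrix n) (a : Fin n → Fin 2 → ℝ) : Set (Fin n → ℝ) :=
  {x | ∀ i δ, -a i δ ≤ A.pairing x i δ}

/-- The class `∑ a_v [D_v]` is Kähler, that is, its support function is strictly convex with
respect to the fan: for every maximal cone (given by the choice `c i` of one of `u_i`, `e_i` for
each `i`) there is a point at which the inequalities of the generators of that cone are equalities
and those of all other generators are strict. Equivalently, the normal fan of the polytope is the
fan, and no inequality is redundant. -/
def IsKahlerClass {n : ℕ} (A : BottMatrix n) (a : Fin n → Fin 2 → ℝ) : Prop :=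
  ∀ c : Fin n → Fin 2, ∃ x : Fin n → ℝ, ∀ i,
    A.pairing x i (c i) = -a i (c i) ∧ ∀ δ, δ ≠ c i → -a i δ < A.pairing x i δ

end BottMatrix

/-- The measure `dσ` with `dv = ± dσ ∧ dℓ` on the hyperplane `ℓ = 0`, `ℓ x = ⟨x, v⟩ + b`, where
`v k ≠ 0`: the hyperplane is the graph of a function of the coordinates `x_j`, `j ≠ k`, and `dσ` is
Lebesgue measure in these coordinates divided by `|∂ℓ/∂x_k| = |v k|`. It does not depend on `k`. -/
def hyperplaneMeasure {d : ℕ} (v : Fin (d + 1) → ℝ) (b : ℝ) (k : Fin (d + 1)) :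
    MeasureTheory.Measure (Fin (d + 1) → ℝ) :=
  ENNReal.ofReal |v k|⁻¹ •
    (MeasureTheory.volume : MeasureTheory.Measure (Fin d → ℝ)).map
      (fun y => k.insertNth (α := fun _ => ℝ) (-(b + ∑ j, y j * v (k.succAbove j)) / v k) y)

namespace BottMatrix

/-- The measure `dσ` on the boundary of the polytope: on the facet of `A.ray i δ` it is the
measure `dσ` of the hyperplane spanned by the facet (the `i`-th coordinate of
`A.ray i δ` is `-1` or `1`). -/
def boundaryMeasure {d : ℕ} (A : BottMatrix (d + 1)) (a : Fin (d + 1) → Fin 2 → ℝ) :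
    MeasureTheory.Measure (Fin (d + 1) → ℝ) :=
  (∑ i, ∑ δ, hyperplaneMeasure (fun j => (A.ray i δ j : ℝ)) (a i δ) i).restrict (A.polytope a)

/-- The Futaki invariant `Vol(P) ∫_{∂P} h dσ - Vol(∂P) ∫_P h dv` of `P = A.polytope a`. -/
def futaki {d : ℕ} (A : BottMatrix (d + 1)) (a : Fin (d + 1) → Fin 2 → ℝ)
    (h : (Fin (d + 1) → ℝ) → ℝ) : ℝ :=
  MeasureTheory.volume.real (A.polytope a) * ∫ x, h x ∂(A.boundaryMeasure a) -
    (A.boundaryMeasure a).real Set.univ * ∫ x in A.polytope a, h x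

end BottMatrix

/-- Coefficients of the slab `P_{[0,s]}`: the first `n` pairs of coefficients are those of the
pillar, and the last pair gives the inequalities `0 ≤ x_n ≤ s` (since `u_n = -e_n`). -/
def slabCoeff {n : ℕ} (a : Fin n → Fin 2 → ℝ) (s : ℝ) : Fin (n + 1) → Fin 2 → ℝ :=
  Fin.snoc (α := fun _ => Fin 2 → ℝ) a ![s, 0]

/-! ### The Bott manifold as a complex manifold -/

/-- `(ℂ² \ {0})ⁿ`; a point `p` has the coordinates `z_i = p i 0` and `w_i = p i 1`. -/
def BottCover {n : ℕ} (_A : BottMatrix n) : Type :=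
  {p : Fin n → Fin 2 → ℂ // ∀ i, p i ≠ 0}

namespace BottMatrix

variable {n : ℕ} (A : BottMatrix n)

/-- The exponent of `t_k` in the action of the torus on `z_i` (`δ = 0`), which is `1` for `k = i`
and `0` otherwise, and on `w_i` (`δ = 1`), which is `a_i^k`. -/
def weight (i : Fin n) (δ : Fin 2) (k : Fin n) : ℤ :=
  if δ = 0 then (1 : Matrix (Fin n) (Fin n) ℤ) i k else A.a i k

/-- The weights of the coordinates `p i (c i)`. -/
def weightMatrix (c : Fin n → Fin 2) : Matrix (Fin n) (Fin n) ℤ :=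
  Matrix.of fun i k => A.weight i (c i) k

/-- The character by which the torus acts on the coordinate `p i δ`. -/
def character (t : Fin n → ℂˣ) (i : Fin n) (δ : Fin 2) : ℂˣ :=
  ∏ k, t k ^ A.weight i δ k

theorem character_one (i : Fin n) (δ : Fin 2) : A.character 1 i δ = 1 := by
  simp [character]

theorem character_mul (s t : Fin n → ℂˣ) (i : Fin n) (δ : Fin 2) :
    A.character (s * t) i δ = A.character s i δ * A.character t i δ := by
  simp [character, mul_zpow, Finset.prod_mul_distrib]

instance : TopologicalSpace (BottCover A) :=
  inferInstanceAs (TopologicalSpace {p : Fin n → Fin 2 → ℂ // ∀ i, p i ≠ 0})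

theorem continuous_coord (i : Fin n) (δ : Fin 2) : Continuous fun p : BottCover A => p.1 i δ :=
  (continuous_apply δ).comp ((continuous_apply i).comp continuous_subtype_val)

/-- The action `t · (z; w) = (t_i z_i; (∏ k, t_k ^ a_i^k) w_i)` of the torus `(ℂˣ)ⁿ`. -/
instance : MulAction (Fin n → ℂˣ) (BottCover A) where
  smul t p := ⟨fun i δ => (A.character t i δ : ℂ) * p.1 i δ, fun i h => p.2 i (by
    funext δ
    have h1 := congrFun h δ
    simpa using h1)⟩
  one_smul p := Subtype.ext (by
    funext i δ
    change (A.character 1 i δ : ℂ) * p.1 i δ = p.1 i δ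
    simp [character_one])
  mul_smul s t p := Subtype.ext (by
    funext i δ
    change (A.character (s * t) i δ : ℂ) * p.1 i δ =
      (A.character s i δ : ℂ) * ((A.character t i δ : ℂ) * p.1 i δ)
    simp [character_mul, mul_assoc])

theorem smul_val (t : Fin n → ℂˣ) (p : BottCover A) (i : Fin n) (δ : Fin 2) :
    (t • p).1 i δ = (A.character t i δ : ℂ) * p.1 i δ := rfl

instance : ContinuousConstSMul (Fin n → ℂˣ) (BottCover A) where
  continuous_const_smul t := by
    refine Continuous.subtype_mk (f := fun p : BottCover A =>
      fun i δ => (A.character t i δ : ℂ) * p.1 i δ) ?_ _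
    exact continuous_pi fun i => continuous_pi fun δ =>
      continuous_const.mul (A.continuous_coord i δ)

end BottMatrix

/-- The Bott manifold `X_n(A) = (ℂ² \ {0})ⁿ / (ℂˣ)ⁿ`, with the quotient topology. -/
def BottManifold {n : ℕ} (A : BottMatrix n) : Type :=
  MulAction.orbitRel.Quotient (Fin n → ℂˣ) (BottCover A)

namespace BottMatrix

variable {n : ℕ} (A : BottMatrix n)

instance : TopologicalSpace (BottManifold A) :=
  inferInstanceAs (TopologicalSpace (Quotient (MulAction.orbitRel (Fin n → ℂˣ) (BottCover A))))

/-- The quotient map. -/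
def proj (p : BottCover A) : BottManifold A :=
  Quotient.mk (MulAction.orbitRel (Fin n → ℂˣ) (BottCover A)) p

theorem isOpenQuotientMap_proj : IsOpenQuotientMap A.proj :=
  MulAction.isOpenQuotientMap_quotientMk

theorem proj_smul (t : Fin n → ℂˣ) (p : BottCover A) : A.proj (t • p) = A.proj p :=
  Quotient.sound (MulAction.orbitRel_apply.mpr ⟨t, rfl⟩)

theorem det_weightMatrix (c : Fin n → Fin 2) : (A.weightMatrix c).det = 1 := by
  rw [Matrix.det_of_isLowerTriangular]
  · refine Finset.prod_eq_one fun i _ => ?_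
    simp only [weightMatrix, weight, Matrix.of_apply]
    split_ifs <;> simp [A.diag]
  · intro i j hij
    have hij' : i < j := hij
    simp only [weightMatrix, weight, Matrix.of_apply]
    split_ifs
    · simp [hij'.ne]
    · exact A.upper _ _ hij'

/-- Exponents of the chart in which the coordinates `p i (c i)` are normalised to `1`. -/
def chartExponent (c : Fin n → Fin 2) : Matrix (Fin n) (Fin n) ℤ :=
  A.weightMatrix (fun i => (c i).rev) * (A.weightMatrix c)⁻¹

theorem chartExponent_mul (c : Fin n → Fin 2) :
    A.chartExponent c * A.weightMatrix c = A.weightMatrix (fun i => (c i).rev) := by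
  rw [chartExponent, Matrix.mul_assoc, Matrix.nonsing_inv_mul _ (by simp [det_weightMatrix]),
    Matrix.mul_one]

/-- The coordinates of the chart in which the coordinates `p i (c i)` are normalised to `1` by the
torus action: the remaining coordinates `p i (c i).rev` after the normalisation. -/
def chartFun (c : Fin n → Fin 2) (p : Fin n → Fin 2 → ℂ) (i : Fin n) : ℂ :=
  p i (c i).rev * ∏ j, p j (c j) ^ (-(A.chartExponent c i j))

end BottMatrix

theorem prod_zpow_mul {n : ℕ} (M N : Matrix (Fin n) (Fin n) ℤ) (t : Fin n → ℂˣ) (i : Fin n) :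
    ∏ j, (∏ k, t k ^ N j k) ^ M i j = ∏ k, t k ^ (M * N) i k := by
  have h1 : ∀ j, (∏ k, t k ^ N j k) ^ M i j = ∏ k, t k ^ (M i j * N j k) := by
    intro j
    rw [← Finset.prod_zpow]
    exact Finset.prod_congr rfl fun k _ => by rw [← zpow_mul, mul_comm]
  have h2 : ∀ (k : Fin n) (f : Fin n → ℤ), t k ^ (∑ j, f j) = ∏ j, t k ^ f j := by
    intro k f
    exact map_sum (AddMonoidHom.mk' (fun m : ℤ => Additive.ofMul (t k ^ m))
      (fun a b => by rw [zpow_add]; rfl)) f Finset.univ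
  simp only [h1, Matrix.mul_apply, h2]
  exact Finset.prod_comm

namespace BottMatrix

variable {n : ℕ} (A : BottMatrix n)

theorem chartFun_smul (c : Fin n → Fin 2) (t : Fin n → ℂˣ) (p : BottCover A) :
    A.chartFun c (t • p).1 = A.chartFun c p.1 := by
  funext i
  have key : A.character t i (c i).rev *
      ∏ j, (A.character t j (c j)) ^ (-(A.chartExponent c i j)) = 1 := by
    simp only [zpow_neg, Finset.prod_inv_distrib]
    rw [mul_inv_eq_one]
    have := prod_zpow_mul (A.chartExponent c) (A.weightMatrix c) t i
    rw [chartExponent_mul] at this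
    exact this.symm
  have key' := congrArg (fun u : ℂˣ => (u : ℂ)) key
  simp only [Units.val_mul, Units.coe_prod, Units.val_zpow_eq_zpow_val, Units.val_one] at key'
  simp only [chartFun, smul_val, mul_zpow, Finset.prod_mul_distrib]
  calc _ = ((A.character t i (c i).rev : ℂ) *
      ∏ j, (A.character t j (c j) : ℂ) ^ (-(A.chartExponent c i j))) * (p.1 i (c i).rev *
        ∏ j, p.1 j (c j) ^ (-(A.chartExponent c i j))) := by ring
    _ = _ := by rw [key', one_mul]

/-- The normalised point with the given remaining coordinates. -/
def chartInvFun (c : Fin n → Fin 2) (x : Fin n → ℂ) : BottCover A :=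
  ⟨fun i δ => if δ = c i then 1 else x i, fun i h => by simpa using congrFun h (c i)⟩

theorem chartFun_chartInvFun (c : Fin n → Fin 2) (x : Fin n → ℂ) :
    A.chartFun c (A.chartInvFun c x).1 = x := by
  have h : ∀ δ : Fin 2, δ.rev ≠ δ := by decide
  funext i
  simp [chartFun, chartInvFun, h]

theorem exists_smul_eq (c : Fin n → Fin 2) (p : BottCover A) (hp : ∀ j, p.1 j (c j) ≠ 0) :
    ∃ t : Fin n → ℂˣ, t • p = A.chartInvFun c (A.chartFun c p.1) := by
  let u : Fin n → ℂˣ := fun j => (Units.mk0 (p.1 j (c j)) (hp j))⁻¹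
  let t : Fin n → ℂˣ := fun k => ∏ j, u j ^ (A.weightMatrix c)⁻¹ k j
  have ht : ∀ i, A.character t i (c i) = u i := by
    intro i
    have := prod_zpow_mul (A.weightMatrix c) (A.weightMatrix c)⁻¹ u i
    rw [Matrix.mul_nonsing_inv _ (by simp [det_weightMatrix])] at this
    refine this.trans ?_
    rw [Finset.prod_eq_single i]
    · simp
    · intro b _ hb
      simp [Matrix.one_apply_ne hb.symm]
    · simp
  have hn : ∀ i, (t • p).1 i (c i) = 1 := by
    intro i
    rw [smul_val, ht]
    simp [u, hp]
  have h2 : ∀ a b : Fin 2, a ≠ b → a = b.rev := by decide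
  refine ⟨t, Subtype.ext ?_⟩
  funext i δ
  rw [← A.chartFun_smul c t p]
  by_cases hδ : δ = c i
  · subst hδ
    simp [chartInvFun, hn]
  · simp only [chartInvFun, hδ, if_false, chartFun, hn, one_zpow, Finset.prod_const_one, mul_one]
    rw [h2 _ _ hδ]

/-- The domain of a chart, upstairs. -/
def chartDomain (c : Fin n → Fin 2) : Set (BottCover A) :=
  {p | ∀ j, p.1 j (c j) ≠ 0}

theorem isOpen_chartDomain (c : Fin n → Fin 2) : IsOpen (A.chartDomain c) := by
  have : A.chartDomain c = ⋂ j, {p | p.1 j (c j) ≠ 0} := by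
    ext p; simp [chartDomain]
  rw [this]
  exact isOpen_iInter_of_finite fun j => isOpen_ne_fun (A.continuous_coord _ _) continuous_const

theorem chartInvFun_mem (c : Fin n → Fin 2) (x : Fin n → ℂ) :
    A.chartInvFun c x ∈ A.chartDomain c := fun j => by simp [chartInvFun]

theorem preimage_image_chartDomain (c : Fin n → Fin 2) :
    A.proj ⁻¹' (A.proj '' A.chartDomain c) = A.chartDomain c := by
  refine Set.Subset.antisymm ?_ (Set.subset_preimage_image _ _)
  rintro p ⟨q, hq, hqp⟩
  obtain ⟨t, ht⟩ := MulAction.orbitRel_apply.mp (Quotient.exact hqp)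
  have ht' : t • p = q := ht
  intro j hj
  refine hq j ?_
  rw [← ht', smul_val, hj, mul_zero]

/-- The chart function on the quotient. -/
def chartQuot (c : Fin n → Fin 2) : BottManifold A → (Fin n → ℂ) :=
  Quotient.lift (fun p : BottCover A => A.chartFun c p.1) (by
    rintro p q h
    obtain ⟨t, ht⟩ := MulAction.orbitRel_apply.mp h
    have ht' : t • q = p := ht
    change A.chartFun c p.1 = A.chartFun c q.1
    rw [← ht', chartFun_smul])

theorem chartQuot_proj (c : Fin n → Fin 2) (p : BottCover A) :
    A.chartQuot c (A.proj p) = A.chartFun c p.1 := rfl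

/-- The chart of the Bott manifold, defined where all coordinates `p i (c i)` are nonzero. -/
def chart (c : Fin n → Fin 2) : OpenPartialHomeomorph (BottManifold A) (Fin n → ℂ) where
  toFun := A.chartQuot c
  invFun x := A.proj (A.chartInvFun c x)
  source := A.proj '' A.chartDomain c
  target := Set.univ
  map_source' _ _ := Set.mem_univ _
  map_target' x _ := ⟨_, A.chartInvFun_mem c x, rfl⟩
  left_inv' := by
    rintro _ ⟨p, hp, rfl⟩
    obtain ⟨t, ht⟩ := A.exists_smul_eq c p hp
    rw [chartQuot_proj, ← ht, proj_smul]
  right_inv' x _ := by rw [chartQuot_proj, chartFun_chartInvFun]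
  open_source := A.isOpenQuotientMap_proj.isOpenMap _ (A.isOpen_chartDomain c)
  open_target := isOpen_univ
  continuousOn_toFun := by
    rw [A.isOpenQuotientMap_proj.isQuotientMap.continuousOn_isOpen_iff
      (A.isOpenQuotientMap_proj.isOpenMap _ (A.isOpen_chartDomain c)),
      preimage_image_chartDomain]
    refine continuousOn_pi.mpr fun i => ?_
    change ContinuousOn (fun p : BottCover A =>
      p.1 i (c i).rev * ∏ j, p.1 j (c j) ^ (-(A.chartExponent c i j))) _
    refine ContinuousOn.mul (A.continuous_coord _ _).continuousOn
      (continuousOn_finsetProd _ fun j _ => ?_)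
    exact ContinuousOn.zpow₀ (A.continuous_coord _ _).continuousOn _ fun p hp => Or.inl (hp j)
  continuousOn_invFun := by
    refine (A.isOpenQuotientMap_proj.continuous.comp ?_).continuousOn
    refine Continuous.subtype_mk (f := fun x : Fin n → ℂ =>
      fun i δ => if δ = c i then (1 : ℂ) else x i) ?_ _
    refine continuous_pi fun i => continuous_pi fun δ => ?_
    split_ifs <;> fun_prop

theorem exists_mem_chart_source (q : BottManifold A) : ∃ c, q ∈ (A.chart c).source := by
  obtain ⟨p, rfl⟩ := A.isOpenQuotientMap_proj.surjective q
  have h : ∀ i, ∃ δ, p.1 i δ ≠ 0 := fun i => Function.ne_iff.mp (p.2 i)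
  choose c hc using h
  exact ⟨c, p, hc, rfl⟩

/-- The atlas of the Bott manifold. -/
instance : ChartedSpace (Fin n → ℂ) (BottManifold A) where
  atlas := Set.range A.chart
  chartAt q := A.chart (A.exists_mem_chart_source q).choose
  mem_chart_source q := (A.exists_mem_chart_source q).choose_spec
  chart_mem_atlas _ := ⟨_, rfl⟩

/-- The Bott manifold is a complex manifold. -/
instance : IsManifold 𝓘(ℂ, Fin n → ℂ) ω (BottManifold A) := by
  refine isManifold_of_contDiffOn _ _ _ ?_
  rintro _ _ ⟨c, rfl⟩ ⟨c', rfl⟩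
  have hsub : (𝓘(ℂ, Fin n → ℂ).symm ⁻¹' ((A.chart c).symm ≫ₕ A.chart c').source ∩
      Set.range 𝓘(ℂ, Fin n → ℂ)) ⊆ {x | ∀ j, (A.chartInvFun c x).1 j (c' j) ≠ 0} := by
    rintro x ⟨hx, -⟩
    have hx' : A.proj (A.chartInvFun c x) ∈ A.proj '' A.chartDomain c' := hx.2
    have : A.chartInvFun c x ∈ A.proj ⁻¹' (A.proj '' A.chartDomain c') := hx'
    rw [preimage_image_chartDomain] at this
    exact this
  refine ContDiffOn.mono ?_ hsub
  have hcoord : ∀ (i : Fin n) (δ : Fin 2),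
      ContDiff ℂ ω fun x : Fin n → ℂ => (A.chartInvFun c x).1 i δ := by
    intro i δ
    simp only [chartInvFun]
    split_ifs
    · exact contDiff_const
    · exact contDiff_apply ℂ ℂ i
  have hz : ∀ (m : ℤ) (j : Fin n), ContDiffOn ℂ ω
      (fun x : Fin n → ℂ => (A.chartInvFun c x).1 j (c' j) ^ m)
      {x | ∀ j, (A.chartInvFun c x).1 j (c' j) ≠ 0} := by
    intro m j
    cases m with
    | ofNat m => simpa using ((hcoord j (c' j)).pow m).contDiffOn
    | negSucc m =>
      simp only [zpow_negSucc]
      exact ((hcoord j (c' j)).pow (m + 1)).contDiffOn.inv fun x hx => pow_ne_zero _ (hx j)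
  change ContDiffOn ℂ ω (fun x => A.chartFun c' (A.chartInvFun c x).1) _
  refine contDiffOn_pi.mpr fun i => ?_
  exact (hcoord i _).contDiffOn.mul (contDiffOn_prod fun j _ => hz _ j)

end BottMatrix

/-- The projective line `(ℂ² \ {0}) / ℂˣ`. -/
abbrev ProjectiveLine : Type := BottManifold BottMatrix.one

end

/-! Let V(t) be the volume and B(t) the boundary mass of the slice of the pillar at height t.
Slicing keeps the truncated matrix and makes the polytope coefficients affine in t, so as long as
the slices are Kähler, V and B are polynomials in t (`exists_eval_eq_vol`,
`exists_eval_eq_boundaryMass`). By Fubini, the vanishing of the Futaki invariant for all heights 0 <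
s ≤ s₀ becomes an integral identity between V and B (`futaki_slab_last`).

Take W with W'' = V and W(0) = W'(0) = 0. The identity then reads (Φ/W)' = -(W'/W)² for a polynomial
Φ built from V and B. If r is a complex root of W of multiplicity μ_r, comparison of poles shows
that Φ/W - Σ μ_r²/(z - r) has no poles, hence is a polynomial, and it is constant because its
derivative vanishes at infinity. The leading terms at infinity now give Σ μ_r² = (Σ μ_r)², so W has
a single root (`Polynomial.roots_subsingleton_of_wronskian_eq`). As V(0) ≠ 0, this root is 0 with
multiplicity 2, so V is constant (`Polynomial.eq_C_of_futaki_eq_zero`).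

The slices at heights 0, s/2 and s thus have equal volume, and the middle one has the averaged
coefficients: this is equality in Brunn–Minkowski. The inequality is proved by induction on
dimension from a one-dimensional Prékopa–Leindler inequality with its equality case. Equality would
make the slices translates of each other; since the facets with normals e_i do not move with the
height, the slices have the same coefficients (`IsKahlerClass.eq_of_vol_eq`). Hence the last row of
A vanishes off the diagonal (`last_row_eq_zero`).

From that one fact the polytope, the fan and the quotient construction all split off an interval,
the fan of P¹ and the manifold P¹ respectively, and the Futaki invariants follow by Fubini. -/

noncomputable section

/-! ### Slices of polytopes at fixed last coordinate. -/

/-- The point of `ℝⁿ⁺¹` with the first coordinates `y` and the last coordinate `z`. -/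
abbrev joinLast {n : ℕ} (y : Fin n → ℝ) (z : ℝ) : Fin (n + 1) → ℝ :=
  Fin.snoc (α := fun _ => ℝ) y z

theorem joinLast_init_last {n : ℕ} (x : Fin (n + 1) → ℝ) :
    joinLast (fun i => x i.castSucc) (x (Fin.last n)) = x :=
  Fin.snoc_init_self (α := fun _ => ℝ) x

namespace BottMatrix

/-- The coefficients of the slice of a polytope at the height `z` of the last coordinate. -/
def sliceCoeff {n : ℕ} (A : BottMatrix (n + 1)) (b : Fin (n + 1) → Fin 2 → ℝ) (z : ℝ) :
    Fin n → Fin 2 → ℝ :=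
  fun i δ => b i.castSucc δ + z * (A.ray i.castSucc δ (Fin.last n) : ℝ)

theorem ray_one {n : ℕ} (A : BottMatrix n) (i j : Fin n) :
    A.ray i 1 j = if j = i then 1 else 0 := by
  simp [ray, Pi.single_apply]

theorem ray_zero {n : ℕ} (A : BottMatrix n) (i j : Fin n) : A.ray i 0 j = - A.a j i := by
  simp [ray]

theorem ray_diag {n : ℕ} (A : BottMatrix n) (i : Fin n) (δ : Fin 2) :
    A.ray i δ i = if δ = 0 then -1 else 1 := by
  fin_cases δ <;> simp [ray, A.diag]

theorem ray_of_lt {n : ℕ} (A : BottMatrix n) {i j : Fin n} (h : j < i) (δ : Fin 2) :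
    A.ray i δ j = 0 := by
  fin_cases δ <;> simp [ray, A.upper _ _ h, h.ne]

theorem abs_ray_diag {n : ℕ} (A : BottMatrix n) (i : Fin n) (δ : Fin 2) :
    |(A.ray i δ i : ℝ)| = 1 := by
  rw [ray_diag]; split_ifs <;> simp

theorem ray_truncate {n : ℕ} (A : BottMatrix (n + 1)) (i j : Fin n) (δ : Fin 2) :
    A.ray i.castSucc δ j.castSucc = A.truncate.ray i δ j := by
  fin_cases δ <;> simp [ray, truncate, Pi.single_apply]

theorem pairing_joinLast {n : ℕ} (A : BottMatrix (n + 1)) (y : Fin n → ℝ) (z : ℝ) (i : Fin n)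
    (δ : Fin 2) : A.pairing (joinLast y z) i.castSucc δ =
      A.truncate.pairing y i δ + z * (A.ray i.castSucc δ (Fin.last n) : ℝ) := by
  simp [pairing, Fin.sum_univ_castSucc, ray_truncate]

theorem ray_last_castSucc {n : ℕ} (A : BottMatrix (n + 1)) (δ : Fin 2) (j : Fin n) :
    A.ray (Fin.last n) δ j.castSucc = 0 :=
  A.ray_of_lt (Fin.castSucc_lt_last j) δ

theorem pairing_last {n : ℕ} (A : BottMatrix (n + 1)) (y : Fin n → ℝ) (z : ℝ) (δ : Fin 2) :
    A.pairing (joinLast y z) (Fin.last n) δ = if δ = 0 then -z else z := by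
  simp only [pairing, Fin.sum_univ_castSucc, ray_last_castSucc, ray_diag]
  split_ifs <;> simp

/-- By triangularity the last two rays are ∓e_n and bound only the height. Every other inequality,
at a fixed height, is one for the truncated matrix with its constant shifted. All later inductions
on dimension rest on this. -/
theorem joinLast_mem_polytope {n : ℕ} (A : BottMatrix (n + 1)) (b : Fin (n + 1) → Fin 2 → ℝ)
    (y : Fin n → ℝ) (z : ℝ) : joinLast y z ∈ A.polytope b ↔
      z ∈ Set.Icc (-b (Fin.last n) 1) (b (Fin.last n) 0) ∧
        y ∈ A.truncate.polytope (A.sliceCoeff b z) := by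
  simp only [polytope, Set.mem_ofPred_eq, Fin.forall_fin_succ' (n := n), pairing_joinLast, pairing_last,
    sliceCoeff, Set.mem_Icc]
  constructor
  · rintro ⟨h1, h2⟩
    refine ⟨⟨by simpa using h2 1, by simpa using h2 0⟩, fun i δ => by linarith [h1 i δ]⟩
  · rintro ⟨⟨h1, h2⟩, h3⟩
    refine ⟨fun i δ => by linarith [h3 i δ], fun δ => ?_⟩
    fin_cases δ <;> simpa

theorem isClosed_polytope {n : ℕ} (A : BottMatrix n) (b : Fin n → Fin 2 → ℝ) :
    IsClosed (A.polytope b) := by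
  simp only [polytope, Set.ofPred_forall]
  refine isClosed_iInter fun i => isClosed_iInter fun δ => isClosed_le continuous_const ?_
  unfold pairing
  fun_prop

/-- The bound is uniform in the coefficients because the induction must bound all slices at once,
and their coefficients vary with the height. -/
theorem exists_bound_polytope {n : ℕ} (A : BottMatrix n) (M : ℝ) :
    ∃ R : ℝ, ∀ b : Fin n → Fin 2 → ℝ, (∀ i δ, |b i δ| ≤ M) →
      ∀ x ∈ A.polytope b, ∀ i, |x i| ≤ R := by
  induction n generalizing M with
  | zero => exact ⟨0, fun _ _ _ _ i => i.elim0⟩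
  | succ n ih =>
    obtain ⟨L, hL⟩ : ∃ L : ℝ, ∀ (i : Fin n) (δ : Fin 2),
        |(A.ray i.castSucc δ (Fin.last n) : ℝ)| ≤ L := by
      refine ⟨∑ i : Fin n, ∑ δ : Fin 2, |(A.ray i.castSucc δ (Fin.last n) : ℝ)|, fun i δ => ?_⟩
      refine le_trans ?_ (Finset.single_le_sum (f := fun i : Fin n => ∑ δ : Fin 2,
        |(A.ray i.castSucc δ (Fin.last n) : ℝ)|) (fun _ _ => by positivity) (Finset.mem_univ i))
      exact Finset.single_le_sum (f := fun δ : Fin 2 =>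
        |(A.ray i.castSucc δ (Fin.last n) : ℝ)|) (fun _ _ => by positivity) (Finset.mem_univ δ)
    obtain ⟨R, hR⟩ := ih A.truncate (M + M * L)
    refine ⟨max R M, fun b hb x hx => ?_⟩
    rw [← joinLast_init_last x, joinLast_mem_polytope] at hx
    obtain ⟨⟨h1, h2⟩, h3⟩ := hx
    have hz : |x (Fin.last n)| ≤ M :=
      abs_le.mpr ⟨by linarith [le_abs_self (b (Fin.last n) 1), hb (Fin.last n) 1],
        by linarith [le_abs_self (b (Fin.last n) 0), hb (Fin.last n) 0]⟩
    refine fun i => Fin.lastCases (hz.trans (le_max_right _ _)) (fun i => ?_) i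
    refine (hR _ (fun j δ => ?_) _ h3 i).trans (le_max_left _ _)
    refine (abs_add_le _ _).trans (add_le_add (hb _ _) ?_)
    rw [abs_mul]
    exact mul_le_mul hz (hL j δ) (abs_nonneg _) ((abs_nonneg _).trans hz)

theorem exists_bound_of_mem_polytope {n : ℕ} (A : BottMatrix n) (b : Fin n → Fin 2 → ℝ) :
    ∃ R : ℝ, ∀ x ∈ A.polytope b, ∀ i, |x i| ≤ R := by
  obtain ⟨R, hR⟩ := A.exists_bound_polytope (∑ i, ∑ δ, |b i δ|)
  refine ⟨R, hR b fun i δ => ?_⟩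
  refine le_trans ?_ (Finset.single_le_sum (f := fun i => ∑ δ, |b i δ|)
    (fun _ _ => by positivity) (Finset.mem_univ i))
  exact Finset.single_le_sum (f := fun δ => |b i δ|) (fun _ _ => by positivity) (Finset.mem_univ δ)

/-! ### The Kähler cone -/

/-- The last entry of the choice `c` puts the vertex on the top (`0`) or the bottom (`1`) facet, so
its height is forced. The remaining conditions say that it is a vertex of that end slice. -/
theorem isKahlerClass_iff {n : ℕ} (A : BottMatrix (n + 1)) (b : Fin (n + 1) → Fin 2 → ℝ) :
    A.IsKahlerClass b ↔ -b (Fin.last n) 1 < b (Fin.last n) 0 ∧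
      A.truncate.IsKahlerClass (A.sliceCoeff b (-b (Fin.last n) 1)) ∧
      A.truncate.IsKahlerClass (A.sliceCoeff b (b (Fin.last n) 0)) := by
  have key : ∀ c : Fin (n + 1) → Fin 2, (∃ x : Fin (n + 1) → ℝ, ∀ i,
      A.pairing x i (c i) = -b i (c i) ∧ ∀ δ, δ ≠ c i → -b i δ < A.pairing x i δ) ↔
      -b (Fin.last n) 1 < b (Fin.last n) 0 ∧ ∃ y : Fin n → ℝ, ∀ i : Fin n,
        A.truncate.pairing y i (c i.castSucc) = -A.sliceCoeff b (if c (Fin.last n) = 0 then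
          b (Fin.last n) 0 else -b (Fin.last n) 1) i (c i.castSucc) ∧
        ∀ δ, δ ≠ c i.castSucc → -A.sliceCoeff b (if c (Fin.last n) = 0 then
          b (Fin.last n) 0 else -b (Fin.last n) 1) i δ < A.truncate.pairing y i δ := by
    intro c
    have hδ : ∀ ε : Fin 2, ε = 0 ∨ ε = 1 := by decide
    constructor
    · rintro ⟨x, hx⟩
      rw [← joinLast_init_last x] at hx
      simp only [Fin.forall_fin_succ' (n := n), pairing_joinLast, pairing_last] at hx
      obtain ⟨h1, h2, h3⟩ := hx
      rcases hδ (c (Fin.last n)) with hc | hc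
      · simp only [hc, if_true] at h2 h3 ⊢
        have := h3 1 (by decide)
        simp only [one_ne_zero, if_false] at this
        have hx : x (Fin.last n) = b (Fin.last n) 0 := by linarith
        rw [hx] at h1 this
        refine ⟨this, fun i => x i.castSucc, fun i => ⟨?_, fun δ hδ => ?_⟩⟩
        · simp only [sliceCoeff]; linarith [(h1 i).1]
        · simp only [sliceCoeff]; linarith [(h1 i).2 δ hδ]
      · simp only [hc, one_ne_zero, if_false] at h2 h3 ⊢
        have := h3 0 (by decide)
        simp only [if_true] at this
        rw [h2] at h1 this
        refine ⟨by linarith, fun i => x i.castSucc, fun i => ⟨?_, fun δ hδ => ?_⟩⟩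
        · simp only [sliceCoeff]; linarith [(h1 i).1]
        · simp only [sliceCoeff]; linarith [(h1 i).2 δ hδ]
    · rintro ⟨h0, y, hy⟩
      refine ⟨joinLast y (if c (Fin.last n) = 0 then b (Fin.last n) 0 else -b (Fin.last n) 1), ?_⟩
      simp only [Fin.forall_fin_succ' (n := n), pairing_joinLast, pairing_last]
      refine ⟨fun i => ⟨?_, fun δ hδ => ?_⟩, ?_, ?_⟩
      · have := (hy i).1; simp only [sliceCoeff] at this; linarith
      · have := (hy i).2 δ hδ; simp only [sliceCoeff] at this; linarith
      · rcases hδ (c (Fin.last n)) with hc | hc <;> simp [hc]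
      · intro δ
        rcases hδ (c (Fin.last n)) with hc | hc <;> rcases hδ δ with rfl | rfl <;> simp [hc] <;>
          linarith
  unfold IsKahlerClass
  simp only [key]
  constructor
  · intro h
    refine ⟨(h 0).1, fun c => ?_, fun c => ?_⟩
    · simpa using (h (Fin.snoc (α := fun _ => Fin 2) c 1)).2
    · simpa using (h (Fin.snoc (α := fun _ => Fin 2) c 0)).2
  · rintro ⟨h0, h1, h2⟩ c
    refine ⟨h0, ?_⟩
    split_ifs
    · exact h2 fun i => c i.castSucc
    · exact h1 fun i => c i.castSucc

theorem pairing_add_smul {n : ℕ} (A : BottMatrix n) (x y : Fin n → ℝ) (s t : ℝ) (i : Fin n)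
    (δ : Fin 2) : A.pairing (s • x + t • y) i δ = s * A.pairing x i δ + t * A.pairing y i δ := by
  simp only [pairing, Pi.add_apply, Pi.smul_apply, smul_eq_mul, Finset.mul_sum,
    ← Finset.sum_add_distrib]
  exact Finset.sum_congr rfl fun j _ => by ring

theorem convex_isKahlerClass {n : ℕ} (A : BottMatrix n) : Convex ℝ {b | A.IsKahlerClass b} := by
  intro b hb b' hb' s t hs ht hst c
  obtain ⟨x, hx⟩ := hb c
  obtain ⟨y, hy⟩ := hb' c
  refine ⟨s • x + t • y, fun i => ⟨?_, fun δ hδ => ?_⟩⟩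
  · rw [pairing_add_smul, (hx i).1, (hy i).1]
    simp only [Pi.add_apply, Pi.smul_apply, smul_eq_mul]; ring
  · rw [pairing_add_smul]
    simp only [Pi.add_apply, Pi.smul_apply, smul_eq_mul]
    have h1 := (hx i).2 δ hδ
    have h2 := (hy i).2 δ hδ
    rcases hs.eq_or_lt with rfl | hs
    · have : t = 1 := by linarith
      subst this; simpa using h2
    · have := mul_lt_mul_of_pos_left h1 hs
      have := mul_le_mul_of_nonneg_left h2.le ht
      linarith

theorem sliceCoeff_combo {n : ℕ} (A : BottMatrix (n + 1)) (b b' : Fin (n + 1) → Fin 2 → ℝ)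
    (z z' s t : ℝ) : A.sliceCoeff (s • b + t • b') (s * z + t * z') =
      s • A.sliceCoeff b z + t • A.sliceCoeff b' z' := by
  funext i δ
  simp only [sliceCoeff, Pi.add_apply, Pi.smul_apply, smul_eq_mul]; ring

/-- Slice coefficients are affine in the height, so an intermediate slice is a convex combination of
the two end slices, and the Kähler cone is convex. -/
theorem IsKahlerClass.sliceCoeff {n : ℕ} {A : BottMatrix (n + 1)} {b : Fin (n + 1) → Fin 2 → ℝ}
    (hb : A.IsKahlerClass b) {z : ℝ} (hz : z ∈ Set.Icc (-b (Fin.last n) 1) (b (Fin.last n) 0)) :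
    A.truncate.IsKahlerClass (A.sliceCoeff b z) := by
  obtain ⟨h0, h1, h2⟩ := (A.isKahlerClass_iff b).mp hb
  rw [← segment_eq_Icc h0.le] at hz
  obtain ⟨s, t, hs, ht, hst, rfl⟩ := hz
  have := A.truncate.convex_isKahlerClass h1 h2 hs ht hst
  rw [← sliceCoeff_combo, ← add_smul, hst, one_smul] at this
  exact this

theorem IsKahlerClass.lt {n : ℕ} {A : BottMatrix (n + 1)} {b : Fin (n + 1) → Fin 2 → ℝ}
    (hb : A.IsKahlerClass b) : -b (Fin.last n) 1 < b (Fin.last n) 0 :=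
  ((A.isKahlerClass_iff b).mp hb).1

end BottMatrix

end

/-! ### Fubini for polytopes and their boundary measures. -/

noncomputable section

open MeasureTheory

theorem integral_joinLast {n : ℕ} {f : (Fin (n + 1) → ℝ) → ℝ} (hf : Integrable f) :
    Integrable (fun z : ℝ => ∫ y : Fin n → ℝ, f (joinLast y z)) ∧
      ∫ x, f x = ∫ z : ℝ, ∫ y : Fin n → ℝ, f (joinLast y z) := by
  have hmp := volume_preserving_piFinSuccAbove (fun _ : Fin (n + 1) => ℝ) (Fin.last n)
  have hs : ∀ p : ℝ × (Fin n → ℝ),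
      (MeasurableEquiv.piFinSuccAbove (fun _ : Fin (n + 1) => ℝ) (Fin.last n)).symm p =
        joinLast p.2 p.1 := fun p => Fin.insertNth_last' p.1 p.2
  have h1 := hmp.symm.integral_comp' (g := f)
  have h2 : Integrable (fun p : ℝ × (Fin n → ℝ) => f (joinLast p.2 p.1)) := by
    have := hmp.symm.integrable_comp_of_integrable hf
    refine this.congr (Filter.Eventually.of_forall fun p => ?_)
    simp only [Function.comp, hs]
  refine ⟨h2.integral_prod_left, ?_⟩
  rw [← h1]
  simp only [hs]
  exact integral_prod _ h2

theorem setIntegral_joinLast {n : ℕ} {S : Set (Fin (n + 1) → ℝ)} (hS : MeasurableSet S)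
    {f : (Fin (n + 1) → ℝ) → ℝ} (hf : IntegrableOn f S) {l u : ℝ} (hlu : l ≤ u)
    (h : ∀ y z, joinLast y z ∈ S → z ∈ Set.Icc l u) :
    IntervalIntegrable (fun z => ∫ y in {y | joinLast y z ∈ S}, f (joinLast y z)) volume l u ∧
      ∫ x in S, f x = ∫ z in l..u, ∫ y in {y | joinLast y z ∈ S}, f (joinLast y z) := by
  have hm : ∀ z, MeasurableSet {y : Fin n → ℝ | joinLast y z ∈ S} := fun z => by
    refine hS.preimage (Continuous.measurable ?_)
    fun_prop
  have h1 : ∀ z : ℝ, ∫ y, S.indicator f (joinLast y z) =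
      ∫ y in {y | joinLast y z ∈ S}, f (joinLast y z) := fun z => by
    rw [← integral_indicator (hm z)]
    rfl
  obtain ⟨h2, h3⟩ := integral_joinLast ((integrable_indicator_iff hS).mpr hf)
  simp only [h1] at h2
  refine ⟨h2.intervalIntegrable, ?_⟩
  rw [← integral_indicator hS, h3, intervalIntegral.integral_of_le hlu, ← integral_Icc_eq_integral_Ioc]
  simp only [h1]
  refine (setIntegral_eq_integral_of_forall_compl_eq_zero fun z hz => ?_).symm
  have : {y : Fin n → ℝ | joinLast y z ∈ S} = ∅ :=
    Set.eq_empty_iff_forall_notMem.mpr fun y hy => hz (h y z hy)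
  rw [this, setIntegral_empty]

theorem isCompact_of_forall_abs_le {n : ℕ} {S : Set (Fin n → ℝ)} (hS : IsClosed S) {R : ℝ}
    (h : ∀ x ∈ S, ∀ i, |x i| ≤ R) : IsCompact S := by
  refine (isCompact_Icc (a := fun _ : Fin n => -R) (b := fun _ => R)).of_isClosed_subset hS ?_
  exact fun x hx => ⟨fun i => (abs_le.mp (h x hx i)).1, fun i => (abs_le.mp (h x hx i)).2⟩

namespace BottMatrix

theorem isCompact_polytope {n : ℕ} (A : BottMatrix n) (b : Fin n → Fin 2 → ℝ) :
    IsCompact (A.polytope b) := by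
  obtain ⟨R, hR⟩ := A.exists_bound_of_mem_polytope b
  exact isCompact_of_forall_abs_le (A.isClosed_polytope b) hR

theorem setIntegral_polytope {n : ℕ} (A : BottMatrix (n + 1)) {b : Fin (n + 1) → Fin 2 → ℝ}
    (hb : -b (Fin.last n) 1 ≤ b (Fin.last n) 0) {h : (Fin (n + 1) → ℝ) → ℝ} (hh : Continuous h) :
    ∫ x in A.polytope b, h x = ∫ z in (-b (Fin.last n) 1)..(b (Fin.last n) 0),
      ∫ y in A.truncate.polytope (A.sliceCoeff b z), h (joinLast y z) := by
  rw [(setIntegral_joinLast (A.isClosed_polytope b).measurableSet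
    (hh.continuousOn.integrableOn_compact (A.isCompact_polytope b)) hb
    fun y z hyz => ((A.joinLast_mem_polytope b y z).mp hyz).1).2]
  refine intervalIntegral.integral_congr fun z hz => ?_
  rw [Set.uIcc_of_le hb] at hz
  have : {y | joinLast y z ∈ A.polytope b} = A.truncate.polytope (A.sliceCoeff b z) := by
    ext y
    exact (A.joinLast_mem_polytope b y z).trans (and_iff_right hz)
  simp only [this]

/-- The parametrisation of the hyperplane spanned by a facet by all coordinates but the one of the
index of the facet. -/
def facetMap {d : ℕ} (A : BottMatrix (d + 1)) (b : Fin (d + 1) → Fin 2 → ℝ) (i : Fin (d + 1))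
    (δ : Fin 2) (y : Fin d → ℝ) : Fin (d + 1) → ℝ :=
  i.insertNth (α := fun _ => ℝ)
    (-(b i δ + ∑ j, y j * (A.ray i δ (i.succAbove j) : ℝ)) / (A.ray i δ i : ℝ)) y

theorem continuous_facetMap {d : ℕ} (A : BottMatrix (d + 1)) (b : Fin (d + 1) → Fin 2 → ℝ)
    (i : Fin (d + 1)) (δ : Fin 2) : Continuous (A.facetMap b i δ) := by
  unfold facetMap
  fun_prop

theorem facetMap_last {n : ℕ} (A : BottMatrix (n + 1)) (b : Fin (n + 1) → Fin 2 → ℝ) (δ : Fin 2)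
    (y : Fin n → ℝ) : A.facetMap b (Fin.last n) δ y =
      joinLast y (if δ = 0 then b (Fin.last n) 0 else -b (Fin.last n) 1) := by
  have hδ : δ = 0 ∨ δ = 1 := by revert δ; decide
  simp only [facetMap, Fin.succAbove_last, ray_last_castSucc, ray_diag, Fin.insertNth_last']
  rcases hδ with rfl | rfl <;> simp

/-- Solving for the coordinate of index `i` commutes with fixing the last coordinate: a slice of a
side facet is a facet of the slice. The diagonal entry ±1 is the same for both, so the measures
match without a Jacobian factor. -/
theorem facetMap_castSucc {n : ℕ} (A : BottMatrix (n + 2)) (b : Fin (n + 2) → Fin 2 → ℝ)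
    (i : Fin (n + 1)) (δ : Fin 2) (y : Fin n → ℝ) (z : ℝ) :
    A.facetMap b i.castSucc δ (joinLast y z) =
      joinLast (A.truncate.facetMap (A.sliceCoeff b z) i δ y) z := by
  have hl : i.castSucc.succAbove (Fin.last n) = Fin.last (n + 1) :=
    Fin.succAbove_ne_last_last (Fin.castSucc_ne_last i)
  have hv : -(b i.castSucc δ + ∑ j : Fin (n + 1), joinLast y z j *
      (A.ray i.castSucc δ (i.castSucc.succAbove j) : ℝ)) / (A.ray i.castSucc δ i.castSucc : ℝ) =
      -(A.sliceCoeff b z i δ + ∑ j, y j * (A.truncate.ray i δ (i.succAbove j) : ℝ)) /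
        (A.truncate.ray i δ i : ℝ) := by
    rw [Fin.sum_univ_castSucc, ray_truncate]
    simp only [Fin.snoc_castSucc, Fin.snoc_last, Fin.castSucc_succAbove_castSucc, ray_truncate, hl,
      sliceCoeff]
    ring
  rw [facetMap, hv, Fin.insertNth_eq_iff]
  refine ⟨by simp [facetMap], ?_⟩
  funext j
  refine Fin.lastCases ?_ (fun j => ?_) j
  · simp [Fin.removeNth, hl]
  · simp [Fin.removeNth, facetMap]

theorem isCompact_preimage_facetMap {d : ℕ} (A : BottMatrix (d + 1))
    (b : Fin (d + 1) → Fin 2 → ℝ) (i : Fin (d + 1)) (δ : Fin 2) :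
    IsCompact (A.facetMap b i δ ⁻¹' A.polytope b) := by
  obtain ⟨R, hR⟩ := A.exists_bound_of_mem_polytope b
  refine isCompact_of_forall_abs_le ((A.isClosed_polytope b).preimage
    (A.continuous_facetMap b i δ)) (R := R) fun y hy j => ?_
  simpa [facetMap] using hR _ hy (i.succAbove j)

/-- The integral of a function over a facet. -/
def facetIntegral {d : ℕ} (A : BottMatrix (d + 1)) (b : Fin (d + 1) → Fin 2 → ℝ)
    (i : Fin (d + 1)) (δ : Fin 2) (h : (Fin (d + 1) → ℝ) → ℝ) : ℝ :=
  ∫ y in A.facetMap b i δ ⁻¹' A.polytope b, h (A.facetMap b i δ y)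

theorem integral_boundaryMeasure {d : ℕ} (A : BottMatrix (d + 1)) (b : Fin (d + 1) → Fin 2 → ℝ)
    {h : (Fin (d + 1) → ℝ) → ℝ} (hh : Continuous h) :
    ∫ x, h x ∂(A.boundaryMeasure b) = ∑ i, ∑ δ, A.facetIntegral b i δ h := by
  have hm : ∀ i δ, (hyperplaneMeasure (fun j => (A.ray i δ j : ℝ)) (b i δ) i) =
      (volume : Measure (Fin d → ℝ)).map (A.facetMap b i δ) := fun i δ => by
    rw [hyperplaneMeasure]
    simp only [abs_ray_diag, inv_one, ENNReal.ofReal_one, one_smul]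
    rfl
  have hP := (A.isClosed_polytope b).measurableSet
  have hr : ∀ i δ, ((volume : Measure (Fin d → ℝ)).map (A.facetMap b i δ)).restrict
      (A.polytope b) =
        (volume.restrict (A.facetMap b i δ ⁻¹' A.polytope b)).map (A.facetMap b i δ) :=
    fun i δ => Measure.restrict_map (A.continuous_facetMap b i δ).measurable hP
  have hi : ∀ i δ, Integrable h
      ((volume.restrict (A.facetMap b i δ ⁻¹' A.polytope b)).map (A.facetMap b i δ)) :=
    fun i δ => (integrable_map_measure hh.aestronglyMeasurable
      (A.continuous_facetMap b i δ).measurable.aemeasurable).mpr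
        ((hh.comp (A.continuous_facetMap b i δ)).continuousOn.integrableOn_compact
          (A.isCompact_preimage_facetMap b i δ))
  have hb : A.boundaryMeasure b = ∑ i, ∑ δ,
      (volume.restrict (A.facetMap b i δ ⁻¹' A.polytope b)).map (A.facetMap b i δ) := by
    rw [boundaryMeasure]
    simp only [← hr, hm]
    simp only [← Measure.restrictₗ_apply, map_sum]
  rw [hb, integral_finsetSum_measure fun i _ => integrable_finsetSum_measure.mpr
    fun δ _ => hi i δ]
  refine Finset.sum_congr rfl fun i _ => ?_
  rw [integral_finsetSum_measure fun δ _ => hi i δ]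
  refine Finset.sum_congr rfl fun δ _ => ?_
  rw [integral_map (A.continuous_facetMap b i δ).measurable.aemeasurable hh.aestronglyMeasurable]
  rfl

theorem facetIntegral_last {n : ℕ} (A : BottMatrix (n + 1)) {b : Fin (n + 1) → Fin 2 → ℝ}
    (hb : -b (Fin.last n) 1 ≤ b (Fin.last n) 0) (δ : Fin 2) (h : (Fin (n + 1) → ℝ) → ℝ) :
    A.facetIntegral b (Fin.last n) δ h =
      ∫ y in A.truncate.polytope (A.sliceCoeff b
        (if δ = 0 then b (Fin.last n) 0 else -b (Fin.last n) 1)),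
          h (joinLast y (if δ = 0 then b (Fin.last n) 0 else -b (Fin.last n) 1)) := by
  have hz : (if δ = 0 then b (Fin.last n) 0 else -b (Fin.last n) 1) ∈
      Set.Icc (-b (Fin.last n) 1) (b (Fin.last n) 0) := by
    split_ifs
    · exact Set.right_mem_Icc.mpr hb
    · exact Set.left_mem_Icc.mpr hb
  have hS : A.facetMap b (Fin.last n) δ ⁻¹' A.polytope b = A.truncate.polytope (A.sliceCoeff b
      (if δ = 0 then b (Fin.last n) 0 else -b (Fin.last n) 1)) := by
    ext y
    rw [Set.mem_preimage, facetMap_last, joinLast_mem_polytope, and_iff_right hz]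
  rw [facetIntegral, hS]
  simp only [facetMap_last]

theorem facetIntegral_castSucc {n : ℕ} (A : BottMatrix (n + 2)) {b : Fin (n + 2) → Fin 2 → ℝ}
    (hb : -b (Fin.last (n + 1)) 1 ≤ b (Fin.last (n + 1)) 0) (i : Fin (n + 1)) (δ : Fin 2)
    {h : (Fin (n + 2) → ℝ) → ℝ} (hh : Continuous h) :
    IntervalIntegrable (fun z => A.truncate.facetIntegral (A.sliceCoeff b z) i δ
      fun y => h (joinLast y z)) volume (-b (Fin.last (n + 1)) 1) (b (Fin.last (n + 1)) 0) ∧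
    A.facetIntegral b i.castSucc δ h =
      ∫ z in (-b (Fin.last (n + 1)) 1)..(b (Fin.last (n + 1)) 0),
        A.truncate.facetIntegral (A.sliceCoeff b z) i δ fun y => h (joinLast y z) := by
  have hcpt := A.isCompact_preimage_facetMap b i.castSucc δ
  have hmem : ∀ y z, joinLast y z ∈ A.facetMap b i.castSucc δ ⁻¹' A.polytope b ↔
      z ∈ Set.Icc (-b (Fin.last (n + 1)) 1) (b (Fin.last (n + 1)) 0) ∧
        y ∈ A.truncate.facetMap (A.sliceCoeff b z) i δ ⁻¹' A.truncate.polytope (A.sliceCoeff b z) :=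
    fun y z => by rw [Set.mem_preimage, facetMap_castSucc, joinLast_mem_polytope]; rfl
  obtain ⟨h1, h2⟩ := setIntegral_joinLast hcpt.isClosed.measurableSet
    ((hh.comp (A.continuous_facetMap b _ δ)).continuousOn.integrableOn_compact hcpt) hb
    fun y z hyz => ((hmem y z).mp hyz).1
  have h3 : Set.EqOn (fun z => ∫ y in {y | joinLast y z ∈
      A.facetMap b i.castSucc δ ⁻¹' A.polytope b}, (h ∘ A.facetMap b i.castSucc δ) (joinLast y z))
      (fun z => A.truncate.facetIntegral (A.sliceCoeff b z) i δ fun y => h (joinLast y z))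
      (Set.uIcc (-b (Fin.last (n + 1)) 1) (b (Fin.last (n + 1)) 0)) := fun z hz => by
    rw [Set.uIcc_of_le hb] at hz
    have : {y | joinLast y z ∈ A.facetMap b i.castSucc δ ⁻¹' A.polytope b} =
        A.truncate.facetMap (A.sliceCoeff b z) i δ ⁻¹'
          A.truncate.polytope (A.sliceCoeff b z) := by
      ext y
      exact (hmem y z).trans (and_iff_right hz)
    simp only [this, facetIntegral, Function.comp, facetMap_castSucc]
  exact ⟨h1.congr (h3.mono Set.uIoc_subset_uIcc), h2.trans (intervalIntegral.integral_congr h3)⟩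

theorem integral_boundaryMeasure_zero (A : BottMatrix 1) {b : Fin 1 → Fin 2 → ℝ}
    (hb : -b (Fin.last 0) 1 ≤ b (Fin.last 0) 0) {h : (Fin 1 → ℝ) → ℝ} (hh : Continuous h) :
    ∫ x, h x ∂(A.boundaryMeasure b) =
      (∫ y in A.truncate.polytope (A.sliceCoeff b (b (Fin.last 0) 0)),
        h (joinLast y (b (Fin.last 0) 0))) +
      ∫ y in A.truncate.polytope (A.sliceCoeff b (-b (Fin.last 0) 1)),
        h (joinLast y (-b (Fin.last 0) 1)) := by
  rw [integral_boundaryMeasure A b hh, Fin.sum_univ_castSucc]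
  simp only [Fin.sum_univ_two, facetIntegral_last A hb]
  simp

/-- The top and bottom facets are the end slices themselves; the side facets fibre over the height
with fibres the facets of the slices. -/
theorem integral_boundaryMeasure_succ {n : ℕ} (A : BottMatrix (n + 2))
    {b : Fin (n + 2) → Fin 2 → ℝ}
    (hb : -b (Fin.last (n + 1)) 1 ≤ b (Fin.last (n + 1)) 0)
    {h : (Fin (n + 2) → ℝ) → ℝ} (hh : Continuous h) :
    ∫ x, h x ∂(A.boundaryMeasure b) =
      (∫ y in A.truncate.polytope (A.sliceCoeff b (b (Fin.last (n + 1)) 0)),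
        h (joinLast y (b (Fin.last (n + 1)) 0))) +
      (∫ y in A.truncate.polytope (A.sliceCoeff b (-b (Fin.last (n + 1)) 1)),
        h (joinLast y (-b (Fin.last (n + 1)) 1))) +
      ∫ z in (-b (Fin.last (n + 1)) 1)..(b (Fin.last (n + 1)) 0),
        ∫ y, h (joinLast y z) ∂(A.truncate.boundaryMeasure (A.sliceCoeff b z)) := by
  have hc : ∀ z, Continuous fun y : Fin (n + 1) → ℝ => h (joinLast y z) := fun z => by fun_prop
  simp only [fun z => integral_boundaryMeasure A.truncate (A.sliceCoeff b z) (hc z)]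
  rw [integral_boundaryMeasure A b hh, Fin.sum_univ_castSucc]
  have hi := fun (i : Fin (n + 1)) (δ : Fin 2) => (facetIntegral_castSucc A hb i δ hh).1
  have hs : ∀ i : Fin (n + 1), IntervalIntegrable (fun z => ∑ δ, A.truncate.facetIntegral
      (A.sliceCoeff b z) i δ fun y => h (joinLast y z)) volume (-b (Fin.last (n + 1)) 1)
      (b (Fin.last (n + 1)) 0) := fun i => by
    simpa only [Fin.sum_univ_two] using (hi i 0).add (hi i 1)
  rw [intervalIntegral.integral_finsetSum fun i _ => hs i]
  simp only [fun i => intervalIntegral.integral_finsetSum fun δ (_ : δ ∈ Finset.univ) => hi i δ]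
  simp only [(facetIntegral_castSucc A hb _ _ hh).2, Fin.sum_univ_two, facetIntegral_last A hb]
  simp only [if_true, one_ne_zero, if_false]
  ring

end BottMatrix

end

/-! ### Polynomiality and positivity of volumes on the Kähler cone. -/

noncomputable section

open MeasureTheory

theorem MvPolynomial.exists_eval_eq_integral {τ : Type*} (q : Polynomial (MvPolynomial τ ℝ))
    (l u : MvPolynomial τ ℝ) : ∃ r : MvPolynomial τ ℝ, ∀ e : τ → ℝ,
      ∫ z in (eval e l)..(eval e u), (q.map (eval e)).eval z = eval e r := by
  induction q using Polynomial.induction_on' with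
  | add p q hp hq =>
    obtain ⟨r, hr⟩ := hp
    obtain ⟨r', hr'⟩ := hq
    refine ⟨r + r', fun e => ?_⟩
    simp only [Polynomial.map_add, Polynomial.eval_add, map_add]
    rw [intervalIntegral.integral_add ((Polynomial.continuous _).intervalIntegrable _ _)
      ((Polynomial.continuous _).intervalIntegrable _ _), hr, hr']
  | monomial k c =>
    refine ⟨c * ((u ^ (k + 1) - l ^ (k + 1)) * C ((k : ℝ) + 1)⁻¹), fun e => ?_⟩
    simp [div_eq_mul_inv]

namespace BottMatrix

theorem exists_eval_eq_sliceCoeff {n : ℕ} (A : BottMatrix (n + 1))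
    (p : MvPolynomial (Fin n × Fin 2) ℝ) :
    ∃ q : Polynomial (MvPolynomial (Fin (n + 1) × Fin 2) ℝ), ∀ (b : Fin (n + 1) → Fin 2 → ℝ)
      (z : ℝ), MvPolynomial.eval (Function.uncurry (A.sliceCoeff b z)) p =
        (q.map (MvPolynomial.eval (Function.uncurry b))).eval z := by
  induction p using MvPolynomial.induction_on with
  | C c => exact ⟨Polynomial.C (MvPolynomial.C c), fun b z => by simp⟩
  | add p q hp hq =>
    obtain ⟨r, hr⟩ := hp
    obtain ⟨r', hr'⟩ := hq
    exact ⟨r + r', fun b z => by simp [hr, hr']⟩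
  | mul_X p i hp =>
    obtain ⟨r, hr⟩ := hp
    refine ⟨r * (Polynomial.C (MvPolynomial.X (i.1.castSucc, i.2)) + Polynomial.X *
      Polynomial.C (MvPolynomial.C (A.ray i.1.castSucc i.2 (Fin.last n) : ℝ))), fun b z => ?_⟩
    simp [hr, sliceCoeff, Function.uncurry]

/-- The volume of a polytope. -/
def vol {n : ℕ} (A : BottMatrix n) (b : Fin n → Fin 2 → ℝ) : ℝ :=
  volume.real (A.polytope b)

/-- The total mass of the boundary measure. -/
def boundaryMass {d : ℕ} (A : BottMatrix (d + 1)) (b : Fin (d + 1) → Fin 2 → ℝ) : ℝ :=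
  (A.boundaryMeasure b).real Set.univ

theorem vol_zero (A : BottMatrix 0) (b : Fin 0 → Fin 2 → ℝ) : A.vol b = 1 := by
  have : A.polytope b = {0} := Set.eq_singleton_iff_unique_mem.mpr
    ⟨fun i => i.elim0, fun x _ => Subsingleton.elim _ _⟩
  rw [vol, this]
  simp [Measure.real, volume_pi, Measure.pi_of_empty (x := (0 : Fin 0 → ℝ))]

theorem setIntegral_const_polytope {n : ℕ} (A : BottMatrix n) (b : Fin n → Fin 2 → ℝ) (c : ℝ) :
    ∫ _ in A.polytope b, c = A.vol b * c := by
  simp [vol]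

theorem vol_eq_integral {n : ℕ} (A : BottMatrix (n + 1)) {b : Fin (n + 1) → Fin 2 → ℝ}
    (hb : -b (Fin.last n) 1 ≤ b (Fin.last n) 0) :
    A.vol b = ∫ z in (-b (Fin.last n) 1)..(b (Fin.last n) 0),
      A.truncate.vol (A.sliceCoeff b z) := by
  have := A.setIntegral_polytope hb (h := fun _ => 1) continuous_const
  simpa only [setIntegral_const_polytope, mul_one] using this

theorem integral_const_boundaryMeasure {d : ℕ} (A : BottMatrix (d + 1))
    (b : Fin (d + 1) → Fin 2 → ℝ) (c : ℝ) :
    ∫ _, c ∂(A.boundaryMeasure b) = A.boundaryMass b * c := by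
  simp [boundaryMass]

theorem boundaryMass_one (A : BottMatrix 1) {b : Fin 1 → Fin 2 → ℝ}
    (hb : -b (Fin.last 0) 1 ≤ b (Fin.last 0) 0) : A.boundaryMass b = 2 := by
  have := A.integral_boundaryMeasure_zero hb (h := fun _ => 1) continuous_const
  simp only [setIntegral_const_polytope, integral_const_boundaryMeasure, vol_zero] at this
  linarith

theorem boundaryMass_eq {n : ℕ} (A : BottMatrix (n + 2)) {b : Fin (n + 2) → Fin 2 → ℝ}
    (hb : -b (Fin.last (n + 1)) 1 ≤ b (Fin.last (n + 1)) 0) :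
    A.boundaryMass b = A.truncate.vol (A.sliceCoeff b (b (Fin.last (n + 1)) 0)) +
      A.truncate.vol (A.sliceCoeff b (-b (Fin.last (n + 1)) 1)) +
      ∫ z in (-b (Fin.last (n + 1)) 1)..(b (Fin.last (n + 1)) 0),
        A.truncate.boundaryMass (A.sliceCoeff b z) := by
  have := A.integral_boundaryMeasure_succ hb (h := fun _ => 1) continuous_const
  simpa only [setIntegral_const_polytope, integral_const_boundaryMeasure, mul_one] using this

/-- All slices of a Kähler polytope are Kähler, so the inductive polynomial applies at every height;
its integral between endpoints that are themselves coefficients is again polynomial. Outside the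
Kähler cone slices can become empty and the formula fails. -/
theorem exists_eval_eq_vol {n : ℕ} (A : BottMatrix n) :
    ∃ p : MvPolynomial (Fin n × Fin 2) ℝ, ∀ b, A.IsKahlerClass b →
      A.vol b = MvPolynomial.eval (Function.uncurry b) p := by
  induction n with
  | zero => exact ⟨1, fun b _ => by simp [vol_zero]⟩
  | succ n ih =>
    obtain ⟨p, hp⟩ := ih A.truncate
    obtain ⟨q, hq⟩ := A.exists_eval_eq_sliceCoeff p
    obtain ⟨r, hr⟩ := MvPolynomial.exists_eval_eq_integral q
      (-MvPolynomial.X (Fin.last n, 1)) (MvPolynomial.X (Fin.last n, 0))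
    refine ⟨r, fun b hb => ?_⟩
    rw [A.vol_eq_integral hb.lt.le, ← hr]
    simp only [map_neg, MvPolynomial.eval_X, Function.uncurry_apply_pair]
    refine intervalIntegral.integral_congr fun z hz => ?_
    rw [Set.uIcc_of_le hb.lt.le] at hz
    exact (hp _ (hb.sliceCoeff hz)).trans (hq b z)

theorem exists_eval_eq_boundaryMass {d : ℕ} (A : BottMatrix (d + 1)) :
    ∃ p : MvPolynomial (Fin (d + 1) × Fin 2) ℝ, ∀ b, A.IsKahlerClass b →
      A.boundaryMass b = MvPolynomial.eval (Function.uncurry b) p := by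
  induction d with
  | zero => exact ⟨MvPolynomial.C 2, fun b hb => by simp [boundaryMass_one A hb.lt.le]⟩
  | succ n ih =>
    obtain ⟨p, hp⟩ := ih A.truncate
    obtain ⟨q, hq⟩ := A.exists_eval_eq_sliceCoeff p
    obtain ⟨r, hr⟩ := MvPolynomial.exists_eval_eq_integral q
      (-MvPolynomial.X (Fin.last (n + 1), 1)) (MvPolynomial.X (Fin.last (n + 1), 0))
    obtain ⟨pv, hpv⟩ := A.truncate.exists_eval_eq_vol
    obtain ⟨qv, hqv⟩ := A.exists_eval_eq_sliceCoeff pv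
    refine ⟨qv.eval (MvPolynomial.X (Fin.last (n + 1), 0)) +
      qv.eval (-MvPolynomial.X (Fin.last (n + 1), 1)) + r, fun b hb => ?_⟩
    rw [A.boundaryMass_eq hb.lt.le, map_add, map_add, ← hr]
    simp only [map_neg, MvPolynomial.eval_X, Function.uncurry_apply_pair]
    congr 1
    · rw [hpv _ (hb.sliceCoeff (Set.right_mem_Icc.mpr hb.lt.le)),
        hpv _ (hb.sliceCoeff (Set.left_mem_Icc.mpr hb.lt.le)), hqv, hqv,
        Polynomial.eval_map, Polynomial.eval_map, ← Polynomial.eval₂_at_apply,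
        ← Polynomial.eval₂_at_apply]
      simp
    · refine intervalIntegral.integral_congr fun z hz => ?_
      rw [Set.uIcc_of_le hb.lt.le] at hz
      exact (hp _ (hb.sliceCoeff hz)).trans (hq b z)

theorem IsKahlerClass.continuousOn_vol_sliceCoeff {n : ℕ} {A : BottMatrix (n + 1)}
    {b : Fin (n + 1) → Fin 2 → ℝ} (hb : A.IsKahlerClass b) :
    ContinuousOn (fun z => A.truncate.vol (A.sliceCoeff b z))
      (Set.Icc (-b (Fin.last n) 1) (b (Fin.last n) 0)) := by
  obtain ⟨p, hp⟩ := A.truncate.exists_eval_eq_vol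
  obtain ⟨q, hq⟩ := A.exists_eval_eq_sliceCoeff p
  refine (Polynomial.continuous
    (q.map (MvPolynomial.eval (Function.uncurry b)))).continuousOn.congr fun z hz => ?_
  exact (hp _ (hb.sliceCoeff hz)).trans (hq b z)

theorem IsKahlerClass.vol_pos {n : ℕ} {A : BottMatrix n} {b : Fin n → Fin 2 → ℝ}
    (hb : A.IsKahlerClass b) : 0 < A.vol b := by
  induction n with
  | zero => simp [vol_zero]
  | succ n ih =>
    rw [A.vol_eq_integral hb.lt.le]
    exact intervalIntegral.intervalIntegral_pos_of_pos_on
      (hb.continuousOn_vol_sliceCoeff.intervalIntegrable_of_Icc hb.lt.le)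
      (fun z hz => ih (hb.sliceCoeff (Set.Ioo_subset_Icc_self hz))) hb.lt

end BottMatrix

end

/-! ### The polynomial identity (Φ/W)' = -(W'/W)² and the constancy of the volume. -/

noncomputable section

namespace Polynomial

theorem X_sub_C_mul_derivative {K : Type*} [Field K] (r : K) (v : ℕ) (Y : K[X]) :
    (X - C r) * derivative ((X - C r) ^ v * Y) =
      (X - C r) ^ v * ((v : K[X]) * Y + (X - C r) * derivative Y) := by
  rw [derivative_mul, derivative_X_sub_C_pow]
  cases v with
  | zero => simp
  | succ v => simp only [Nat.add_sub_cancel, pow_succ, map_natCast]; ring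

/-- The local behaviour at a root `r` of `W` of a polynomial `Φ` with `(Φ / W)' = -(W' / W) ^ 2`. -/
theorem pow_dvd_sub_of_wronskian_eq {K : Type*} [Field K] [CharZero K] {r : K} {m : ℕ}
    {U W Φ : K[X]} (hU : U.eval r ≠ 0) (hW : W = (X - C r) ^ (m + 1) * U)
    (h : derivative Φ * W - Φ * derivative W = -(derivative W) ^ 2) :
    (X - C r) ^ (m + 1) ∣ Φ - ((m + 1 : ℕ) : K[X]) ^ 2 * ((X - C r) ^ m * U) := by
  set L : K[X] := X - C r with hL
  have hL0 : L ≠ 0 := X_sub_C_ne_zero r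
  set Φ₁ : K[X] := Φ - ((m + 1 : ℕ) : K[X]) ^ 2 * (L ^ m * U) with hΦ₁
  -- With μ = m + 1, subtracting μ²/(z - r) from Φ/W removes the double pole of (W'/W)². Hence
  -- (Φ₁/W)' has at most a simple pole at r, whereas a pole of Φ₁/W would give its derivative a pole
  -- of order at least two. The rest of the proof is this argument with denominators cleared.
  by_contra hdvd
  have hne : Φ₁ ≠ 0 := fun h0 => hdvd (h0 ▸ dvd_zero _)
  obtain ⟨Y, hY, hYr⟩ := exists_eq_pow_rootMultiplicity_mul_and_not_dvd Φ₁ hne r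
  set v := rootMultiplicity r Φ₁
  have hv : v ≤ m := by
    by_contra hv
    exact hdvd (hY ▸ (pow_dvd_pow L (by omega)).trans (dvd_mul_right _ _))
  rw [dvd_iff_isRoot] at hYr
  have dW : derivative W = L ^ m * (((m + 1 : ℕ) : K[X]) * U + L * derivative U) := by
    refine mul_left_cancel₀ hL0 ?_
    rw [hW, X_sub_C_mul_derivative, pow_succ]; ring
  have dΦ₁ : L * derivative Φ₁ = L ^ v * ((v : K[X]) * Y + L * derivative Y) := by
    rw [hY, X_sub_C_mul_derivative]
  have dΦ : L * derivative Φ = L * derivative Φ₁ +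
      ((m + 1 : ℕ) : K[X]) ^ 2 * (L ^ m * ((m : K[X]) * U + L * derivative U)) := by
    have : Φ = Φ₁ + ((m + 1 : ℕ) : K[X]) ^ 2 * (L ^ m * U) := by rw [hΦ₁]; ring
    rw [this, derivative_add, mul_add, ← X_sub_C_mul_derivative, ← Nat.cast_pow,
      ← C_eq_natCast, derivative_C_mul]
    ring
  have hΦ : Φ = L ^ v * Y + ((m + 1 : ℕ) : K[X]) ^ 2 * (L ^ m * U) := by
    rw [← hY, hΦ₁]; ring
  have key : L ^ (m + v) * (U * ((v : K[X]) * Y + L * derivative Y) -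
      Y * (((m + 1 : ℕ) : K[X]) * U + L * derivative U) + L ^ (m - v + 1) *
        (2 * ((m + 1 : ℕ) : K[X]) * U * derivative U + L * derivative U ^ 2)) = 0 := by
    have e1 : derivative Φ * W = L ^ m * U * (L * derivative Φ) := by rw [hW]; ring
    rw [e1, dΦ, dΦ₁, dW, hΦ] at h
    have e2 : L ^ (m + v) * L ^ (m - v + 1) = L ^ (2 * m + 1) := by
      rw [← pow_add]; congr 1; omega
    rw [mul_add, ← mul_assoc (L ^ (m + v)) (L ^ (m - v + 1)), e2]
    rw [← sub_eq_zero] at h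
    rw [← h, pow_add, Nat.cast_add, Nat.cast_one]
    ring
  -- Since v ≤ m, the factor L ^ (m - v + 1) vanishes at r, and only the leading terms (v - (m + 1))
  -- U(r) Y(r) survive.
  have := congrArg (eval r) ((mul_eq_zero.mp key).resolve_left (pow_ne_zero _ hL0))
  simp only [hL, eval_add, eval_sub, eval_mul, eval_natCast, eval_pow, eval_X, eval_C, sub_self,
    zero_mul, add_zero, eval_zero, zero_pow (Nat.succ_ne_zero _)] at this
  have h2 : ((v : K) - ((m + 1 : ℕ) : K)) * (U.eval r * Y.eval r) = 0 := by
    linear_combination this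
  rcases mul_eq_zero.mp h2 with h3 | h3
  · have : v = m + 1 := by exact_mod_cast sub_eq_zero.mp h3
    omega
  · exact (mul_ne_zero hU hYr) h3

/-- If `(Φ / W)' = -(W' / W) ^ 2`, then `W` has only one root. -/
theorem roots_subsingleton_of_wronskian_eq {K : Type*} [Field K] [CharZero K] {W Φ : K[X]}
    (hs : W.Splits) (h : derivative Φ * W - Φ * derivative W = -(derivative W) ^ 2)
    {r r' : K} (hr : r ∈ W.roots) (hr' : r' ∈ W.roots) : r = r' := by
  classical
  have hW0 : W ≠ 0 := fun h0 => by simp [h0] at hr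
  set S := W.roots.toFinset with hS
  set μ : K → ℕ := fun r => rootMultiplicity r W with hμ
  set Q : K → K[X] := fun r => W /ₘ (X - C r) with hQ
  have hroot : ∀ r ∈ S, W.IsRoot r := fun r hr =>
    (mem_roots hW0).mp (Multiset.mem_toFinset.mp hr)
  have hμ0 : ∀ r ∈ S, 0 < μ r := fun r hr => (rootMultiplicity_pos hW0).mpr (hroot r hr)
  have hQW : ∀ r ∈ S, (X - C r) * Q r = W := fun r hr =>
    mul_divByMonic_eq_iff_isRoot.mpr (hroot r hr)
  -- Θ/W is the sum of the principal parts μ_r²/(z - r) of Φ/W.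
  set Θ : K[X] := ∑ r ∈ S, ((μ r : ℕ) : K[X]) ^ 2 * Q r with hΘ
  have hdvd : ∀ r ∈ S, (X - C r) ^ μ r ∣ Φ - Θ := by
    intro r hr
    obtain ⟨U, hU, hUr⟩ := exists_eq_pow_rootMultiplicity_mul_and_not_dvd W hW0 r
    obtain ⟨m, hm⟩ := Nat.exists_eq_succ_of_ne_zero (hμ0 r hr).ne'
    have hm' : rootMultiplicity r W = m + 1 := hm
    rw [hm'] at hU
    rw [dvd_iff_isRoot] at hUr
    have h1 := pow_dvd_sub_of_wronskian_eq hUr hU h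
    have h2 : Q r = (X - C r) ^ m * U := by
      refine mul_left_cancel₀ (X_sub_C_ne_zero r) ?_
      rw [hQW r hr]; nth_rw 1 [hU]; rw [pow_succ]; ring
    rw [hm, hΘ, ← Finset.add_sum_erase _ _ hr, hm, h2, ← sub_sub]
    refine dvd_sub h1 (Finset.dvd_sum fun r₂ hr₂ => Dvd.dvd.mul_left ?_ _)
    -- The principal part at another root r₂ is regular at r: `Q r₂` still contains the full power
    -- of X - r.
    have hcop : IsCoprime ((X - C r) ^ (m + 1)) (X - C r₂) :=
      (isCoprime_X_sub_C_of_isUnit_sub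
        (sub_ne_zero.mpr (Finset.ne_of_mem_erase hr₂).symm).isUnit).pow_left
    refine hcop.dvd_of_dvd_mul_left ?_
    rw [hQW r₂ (Finset.mem_of_mem_erase hr₂), hU]
    exact dvd_mul_right _ _
  have hWdvd : W ∣ Φ - Θ := by
    rcases eq_or_ne (Φ - Θ) 0 with h0 | h0
    · rw [h0]; exact dvd_zero _
    · refine hs.dvd_of_roots_le_roots hW0 (Multiset.le_iff_count.mpr fun r => ?_)
      rw [count_roots, count_roots]
      by_cases hr : r ∈ S
      · exact (le_rootMultiplicity_iff h0).mpr (hdvd r hr)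
      · have : ¬ W.IsRoot r := fun hroot =>
          hr (Multiset.mem_toFinset.mpr ((mem_roots hW0).mpr hroot))
        rw [rootMultiplicity_eq_zero this]; exact Nat.zero_le _
  obtain ⟨E, hE⟩ := hWdvd
  have hΦ : Φ = Θ + W * E := by rw [← hE]; ring
  have hd : 0 < W.natDegree := by
    rw [hs.natDegree_eq_card_roots]
    exact Multiset.card_pos_iff_exists_mem.mpr ⟨r, hr⟩
  obtain ⟨k, hk⟩ := Nat.exists_eq_succ_of_ne_zero hd.ne'
  have hQd : ∀ r, (Q r).natDegree = k := fun r => by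
    rw [hQ]; simp only; rw [natDegree_divByMonic _ (monic_X_sub_C r), hk]; simp
  have hQc : ∀ r ∈ S, (Q r).coeff k = W.leadingCoeff := fun r hr => by
    rw [← hQW r hr, leadingCoeff_mul, leadingCoeff_X_sub_C, one_mul, leadingCoeff, hQd]
  have hΘd : Θ.natDegree ≤ k := natDegree_sum_le_of_forall_le _ _ fun r _ => by
    rw [← Nat.cast_pow, ← C_eq_natCast]
    exact (natDegree_C_mul_le _ _).trans (hQd r).le
  have hΘc : Θ.coeff k = (∑ r ∈ S, (μ r : K) ^ 2) * W.leadingCoeff := by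
    rw [hΘ, finsetSum_coeff, Finset.sum_mul]
    refine Finset.sum_congr rfl fun r hr => ?_
    rw [← Nat.cast_pow, ← C_eq_natCast, coeff_C_mul, hQc r hr, Nat.cast_pow]
  have hWd' : (derivative W).natDegree ≤ k := (natDegree_derivative_le W).trans (by omega)
  have hWc' : (derivative W).coeff k = W.leadingCoeff * (k + 1) := by
    rw [coeff_derivative, leadingCoeff, hk]
  have hEW : derivative Θ * W - Θ * derivative W + derivative E * W ^ 2 =
      -(derivative W) ^ 2 := by
    rw [← h, hΦ]; simp only [derivative_add, derivative_mul]; ring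
  -- With deg W = k + 1, a nonzero E' would make E' W² of degree at least 2k + 2, and every other
  -- term has degree at most 2k + 1.
  have hE0 : derivative E = 0 := by
    by_contra hE0
    have h1 : derivative E * W ^ 2 =
        -(derivative W) ^ 2 - derivative Θ * W + Θ * derivative W := by rw [← hEW]; ring
    have h2 := congrArg natDegree h1
    rw [natDegree_mul hE0 (pow_ne_zero 2 hW0), natDegree_pow, hk] at h2
    have h3 : (-(derivative W) ^ 2 - derivative Θ * W + Θ * derivative W).natDegree ≤
        2 * k + 1 := by
      refine (natDegree_add_le _ _).trans (max_le ((natDegree_sub_le _ _).trans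
        (max_le ?_ ?_)) ?_)
      · rw [natDegree_neg]; exact natDegree_pow_le.trans (by omega)
      · refine natDegree_mul_le.trans ?_
        have := natDegree_derivative_le Θ
        omega
      · exact natDegree_mul_le.trans (by omega)
    omega
  have hXΘd : (X * derivative Θ).natDegree ≤ k := by
    rcases eq_or_ne (derivative Θ) 0 with h0 | h0
    · simp [h0]
    · rw [natDegree_X_mul h0]
      have h1 : Θ.natDegree ≠ 0 := fun h1 => h0 (derivative_of_natDegree_zero h1)
      have := natDegree_derivative_lt h1
      omega
  have hXΘc : (X * derivative Θ).coeff k = k * Θ.coeff k := by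
    cases k with
    | zero => simp
    | succ j => rw [coeff_X_mul, coeff_derivative]; push_cast; ring
  have hXd : (X * Θ).natDegree ≤ k + 1 := natDegree_mul_le.trans (by simp; omega)
  have hX2d : (X * derivative W).natDegree ≤ k + 1 := natDegree_mul_le.trans (by simp; omega)
  -- This compares the coefficients of degree 2k, that is, the z⁻² terms at infinity. The factor X
  -- replaces Θ' by XΘ', whose coefficient of degree k is k times that of Θ even when k = 0.
  have hc := congrArg (fun p => (X * p).coeff (k + 1 + k)) hEW
  simp only [hE0, zero_mul, add_zero, mul_sub, coeff_sub, mul_neg, coeff_neg, sq] at hc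
  rw [← mul_assoc X, ← mul_assoc X, ← mul_assoc X, coeff_mul_add_eq_of_natDegree_le hXd hWd',
    coeff_mul_add_eq_of_natDegree_le hX2d hWd', show k + 1 + k = k + (k + 1) by ring,
    coeff_mul_add_eq_of_natDegree_le hXΘd hk.le, coeff_X_mul, coeff_X_mul, hXΘc, hWc', hΘc,
    show W.coeff (k + 1) = W.leadingCoeff by rw [leadingCoeff, hk]] at hc
  have hl : W.leadingCoeff ≠ 0 := leadingCoeff_ne_zero.mpr hW0
  have hsum : ∑ r ∈ S, (μ r : K) ^ 2 = ((k : K) + 1) ^ 2 := by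
    refine mul_right_cancel₀ (pow_ne_zero 2 hl) ?_
    linear_combination -hc
  have hcard : ∑ r ∈ S, μ r = k + 1 := by
    rw [← Nat.succ_eq_add_one, ← hk, hs.natDegree_eq_card_roots, ← Multiset.toFinset_sum_count_eq]
    exact Finset.sum_congr rfl fun r _ => (count_roots W).symm
  have hsum' : ∑ r ∈ S, μ r ^ 2 = (k + 1) ^ 2 := by exact_mod_cast hsum
  by_contra hne
  have hrS : r ∈ S := Multiset.mem_toFinset.mpr hr
  have hrS' : r' ∈ S := Multiset.mem_toFinset.mpr hr'
  have hle : ∀ r ∈ S, μ r ≤ k + 1 := fun r hr => by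
    rw [← hcard]; exact Finset.single_le_sum (f := μ) (fun _ _ => Nat.zero_le _) hr
  have hlt : μ r < k + 1 := by
    have h1 := Finset.add_sum_erase S μ hrS
    have h2 := Finset.single_le_sum (f := μ) (s := S.erase r) (fun _ _ => Nat.zero_le _)
      (Finset.mem_erase.mpr ⟨Ne.symm hne, hrS'⟩)
    have := hμ0 r' hrS'
    omega
  -- Two distinct roots would make some multiplicity less than their sum k + 1, and then the sum of
  -- squares is strictly less than the square of the sum.
  have : ∑ r ∈ S, μ r ^ 2 < ∑ r ∈ S, μ r * (k + 1) := by
    refine Finset.sum_lt_sum (fun r hr => ?_) ⟨r, hrS, ?_⟩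
    · rw [sq]; exact Nat.mul_le_mul_left _ (hle r hr)
    · rw [sq]; exact Nat.mul_lt_mul_of_pos_left hlt (hμ0 r hrS)
  rw [← Finset.sum_mul, hcard, hsum', sq] at this
  exact lt_irrefl _ this

theorem exists_derivative_eq (P : ℝ[X]) : ∃ Q : ℝ[X], derivative Q = P ∧ Q.coeff 0 = 0 := by
  induction P using Polynomial.induction_on' with
  | add p q hp hq =>
    obtain ⟨r, hr, hr0⟩ := hp
    obtain ⟨r', hr', hr0'⟩ := hq
    exact ⟨r + r', by simp [hr, hr'], by simp [hr0, hr0']⟩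
  | monomial k c =>
    refine ⟨monomial (k + 1) (c / (k + 1)), ?_, by simp [coeff_monomial]⟩
    rw [derivative_monomial]
    have : (k : ℝ) + 1 ≠ 0 := by positivity
    simp [this]

/-- Over ℂ the polynomial W splits and has only one root, which is 0, so it is a monomial; its
nonzero coefficient of degree 2 fixes the degree. -/
theorem eq_C_of_wronskian_eq {W Φ : ℝ[X]} (h0 : W.coeff 0 = 0) (h1 : W.coeff 1 = 0)
    (h2 : W.coeff 2 ≠ 0) (h : derivative Φ * W - Φ * derivative W = -(derivative W) ^ 2) :
    W = C (W.coeff 2) * X ^ 2 := by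
  set W' : ℂ[X] := W.map (algebraMap ℝ ℂ) with hW'
  have h' : derivative (Φ.map (algebraMap ℝ ℂ)) * W' -
      Φ.map (algebraMap ℝ ℂ) * derivative W' = -(derivative W') ^ 2 := by
    have := congrArg (Polynomial.map (algebraMap ℝ ℂ)) h
    simpa [hW', Polynomial.derivative_map] using this
  have hs : W'.Splits := IsAlgClosed.splits W'
  have hW0 : W' ≠ 0 := fun h => h2 (by
    have := congrArg (fun p => p.coeff 2) h
    simpa [hW'] using this)
  have hr0 : (0 : ℂ) ∈ W'.roots := by
    rw [mem_roots hW0, IsRoot.def, ← coeff_zero_eq_eval_zero]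
    simp [hW', h0]
  have hroots : W'.roots = Multiset.replicate W'.natDegree 0 := by
    rw [Multiset.eq_replicate]
    exact ⟨hs.natDegree_eq_card_roots.symm,
      fun r hr => roots_subsingleton_of_wronskian_eq hs h' hr hr0⟩
  have hX : W' = C W'.leadingCoeff * X ^ W'.natDegree := by
    have := hs.eq_prod_roots
    rw [hroots] at this
    simpa using this
  have hd : W'.natDegree = 2 := by
    by_contra hd
    have := congrArg (fun p => p.coeff 2) hX
    simp only [coeff_C_mul, coeff_X_pow, if_neg (Ne.symm hd), mul_zero] at this
    exact h2 (by simpa [hW'] using this)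
  have hd' : W.natDegree = 2 := by rwa [hW', natDegree_map] at hd
  ext j
  rw [coeff_C_mul, coeff_X_pow]
  split_ifs with hj
  · rw [hj, mul_one]
  · rw [mul_zero]
    rcases lt_or_ge 2 j with hj2 | hj2
    · exact coeff_eq_zero_of_natDegree_lt (hd' ▸ hj2)
    · interval_cases j
      · exact h0
      · exact h1
      · exact absurd rfl hj

/-- Integration by parts writes the first moments through second antiderivatives. The hypothesis
then becomes the identity Φ'W - ΦW' + W'² = 0 on an interval, hence identically. -/
theorem eq_C_of_futaki_eq_zero {V B : ℝ[X]} {s₀ : ℝ} (hs₀ : 0 < s₀) (hV : V.eval 0 ≠ 0)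
    (h : ∀ s ∈ Set.Ioc 0 s₀, (∫ t in 0..s, V.eval t) * (s * V.eval s + ∫ t in 0..s, t * B.eval t) -
      (V.eval s + V.eval 0 + ∫ t in 0..s, B.eval t) * ∫ t in 0..s, t * V.eval t = 0) :
    V = C (V.eval 0) := by
  obtain ⟨V₁, hV₁, hV₁0⟩ := exists_derivative_eq V
  obtain ⟨W, hW, hW0⟩ := exists_derivative_eq V₁
  obtain ⟨B₁, hB₁, hB₁0⟩ := exists_derivative_eq B
  obtain ⟨β, hβ, hβ0⟩ := exists_derivative_eq B₁
  rw [coeff_zero_eq_eval_zero] at hV₁0 hB₁0 hβ0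
  have hW0' := hW0
  rw [coeff_zero_eq_eval_zero] at hW0'
  have int1 : ∀ (P P₁ : ℝ[X]), derivative P₁ = P → P₁.eval 0 = 0 → ∀ s : ℝ,
      ∫ t in 0..s, P.eval t = P₁.eval s := by
    intro P P₁ hP h0 s
    rw [intervalIntegral.integral_eq_sub_of_hasDerivAt
      (fun t _ => by simpa [hP] using P₁.hasDerivAt t)
      (P.continuous.intervalIntegrable _ _), h0, sub_zero]
  have int2 : ∀ (P P₁ P₂ : ℝ[X]), derivative P₁ = P → derivative P₂ = P₁ → P₂.eval 0 = 0 →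
      ∀ s : ℝ, ∫ t in 0..s, t * P.eval t = s * P₁.eval s - P₂.eval s := by
    intro P P₁ P₂ hP hP₁ h0 s
    have := int1 (X * P) (X * P₁ - P₂) (by simp [hP, hP₁]) (by simp [h0]) s
    simpa using this
  -- Chosen so that Φ' is the boundary mass of the slab of height s. The products containing s
  -- cancel in the hypothesis except s V(0) V₁, which the linear term of Φ absorbs; the summand V₁ =
  -- W' produces the square W'².
  set Φ : ℝ[X] := β + V₁ + C (V.eval 0) * X with hΦ
  have hdΦ : derivative Φ = B₁ + V + C (V.eval 0) := by simp [hΦ, hβ, hV₁]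
  have key : derivative Φ * W - Φ * derivative W + derivative W ^ 2 = 0 := by
    refine eq_zero_of_infinite_isRoot _ ((Set.Ioc_infinite hs₀).mono fun s hs => ?_)
    have := h s hs
    rw [int1 V V₁ hV₁ hV₁0, int1 B B₁ hB₁ hB₁0, int2 V V₁ W hV₁ hW hW0',
      int2 B B₁ β hB₁ hβ hβ0] at this
    change eval s _ = 0
    rw [hdΦ, hW, hΦ]
    simp only [eval_add, eval_sub, eval_mul, eval_pow, eval_C, eval_X]
    linear_combination this
  have hW2 : W.coeff 2 = V.eval 0 / 2 := by
    have e1 : V.eval 0 = V₁.coeff 1 := by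
      rw [← coeff_zero_eq_eval_zero, ← hV₁, coeff_derivative]; simp
    have e2 : V₁.coeff 1 = W.coeff 2 * 2 := by
      rw [← hW, coeff_derivative]; norm_num
    rw [e1, e2]; ring
  have hW1 : W.coeff 1 = 0 := by
    have : V₁.coeff 0 = W.coeff 1 := by rw [← hW, coeff_derivative]; simp
    rw [← this, coeff_zero_eq_eval_zero, hV₁0]
  have := eq_C_of_wronskian_eq hW0 hW1 (by rw [hW2]; exact div_ne_zero hV two_ne_zero)
    (eq_neg_of_add_eq_zero_left key)
  have e3 : V = derivative (derivative W) := by rw [hW, hV₁]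
  rw [hW2] at this
  nth_rw 1 [e3]
  rw [this]
  simp only [derivative_C_mul, derivative_X_pow]
  simp only [Nat.cast_ofNat, Nat.add_one_sub_one, Nat.cast_one, map_one, Nat.sub_self,
    pow_zero, mul_one]
  rw [← C_mul, div_mul_cancel₀ _ two_ne_zero]

end Polynomial

end

/-! ### Prékopa–Leindler on the line and Brunn–Minkowski with equality. -/

noncomputable section

open MeasureTheory

/-- T solves F₁(T x) = c F₀(x) for the antiderivatives F₀, F₁. The lower bound m on f₁ makes F₁ - m
x monotone, so F₁ is an increasing bijection of ℝ and can be inverted globally. -/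
theorem exists_transport {f₀ f₁ : ℝ → ℝ} (h₀ : Continuous f₀) (h₁ : Continuous f₁) {m : ℝ}
    (hm : 0 < m) (hm₁ : ∀ x, m ≤ f₁ x) (l₀ l₁ c : ℝ) :
    ∃ T : ℝ → ℝ, T l₀ = l₁ ∧ (∀ x, HasDerivAt T (c * f₀ x / f₁ (T x)) x) ∧
      ∀ x, ∫ t in l₁..T x, f₁ t = c * ∫ t in l₀..x, f₀ t := by
  set F : ℝ → ℝ := fun x => ∫ t in l₁..x, f₁ t with hF
  have hd : ∀ x, HasDerivAt F (f₁ x) x := fun x => h₁.integral_hasStrictDerivAt l₁ x |>.hasDerivAt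
  have hpos : ∀ x, 0 < f₁ x := fun x => hm.trans_le (hm₁ x)
  have hmono : StrictMono F := strictMono_of_hasDerivAt_pos hd hpos
  have hcont : Continuous F := continuous_iff_continuousAt.mpr fun x => (hd x).continuousAt
  have hmono' : Monotone fun x => F x - m * x := by
    refine monotone_of_deriv_nonneg (fun x => ?_) fun x => ?_
    · exact ((hd x).sub ((hasDerivAt_id x).const_mul m)).differentiableAt
    · have := ((hd x).sub ((hasDerivAt_id x).const_mul m)).deriv
      have h2 := hm₁ x
      simp only [id, mul_one] at this
      rw [show (fun x => F x - m * x) = F - fun y => m * y from rfl, this]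
      linarith
  have hF0 : F l₁ = 0 := by simp [hF]
  have htop : Filter.Tendsto F Filter.atTop Filter.atTop := by
    have h2 : Filter.Tendsto (fun x : ℝ => m * x + -(m * l₁)) Filter.atTop Filter.atTop :=
      Filter.tendsto_atTop_add_const_right _ _ (Filter.tendsto_id.const_mul_atTop hm)
    refine Filter.tendsto_atTop_mono' _ ?_ h2
    filter_upwards [Filter.eventually_ge_atTop l₁] with x hx
    have := hmono' hx
    simp only [hF0] at this
    linarith
  have hbot : Filter.Tendsto F Filter.atBot Filter.atBot := by
    have h2 : Filter.Tendsto (fun x : ℝ => m * x + -(m * l₁)) Filter.atBot Filter.atBot :=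
      Filter.tendsto_atBot_add_const_right _ _ (Filter.tendsto_id.const_mul_atBot hm)
    refine Filter.tendsto_atBot_mono' _ ?_ h2
    filter_upwards [Filter.eventually_le_atBot l₁] with x hx
    have := hmono' hx
    simp only [hF0] at this
    linarith
  let e : ℝ ≃o ℝ := hmono.orderIsoOfSurjective F (hcont.surjective htop hbot)
  have he : ∀ y, F (e.symm y) = y := fun y => e.apply_symm_apply y
  have hes : ∀ y, HasDerivAt e.symm (f₁ (e.symm y))⁻¹ y := fun y =>
    HasDerivAt.of_local_left_inverse e.symm.continuous.continuousAt (hd _) (hpos _).ne'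
      (Filter.Eventually.of_forall he)
  refine ⟨fun x => e.symm (c * ∫ t in l₀..x, f₀ t), ?_, fun x => ?_, fun x => he _⟩
  · have h0 : e l₁ = 0 := hF0
    simp only [intervalIntegral.integral_same, mul_zero]
    rw [← h0, e.symm_apply_apply]
  · have := (hes (c * ∫ t in l₀..x, f₀ t)).comp x
      ((h₀.integral_hasStrictDerivAt l₀ x).hasDerivAt.const_mul c)
    refine this.congr_deriv ?_
    rw [div_eq_inv_mul]

theorem eq_of_intervalIntegral_eq {f : ℝ → ℝ} (hf : Continuous f) (hpos : ∀ x, 0 < f x)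
    {l x y : ℝ} (h : ∫ t in l..x, f t = ∫ t in l..y, f t) : x = y := by
  have hmono : StrictMono fun x => ∫ t in l..x, f t :=
    strictMono_of_hasDerivAt_pos (fun x => (hf.integral_hasStrictDerivAt l x).hasDerivAt) hpos
  exact hmono.injective h

/-- Substitute the midpoint of x and T x into the integral of g, where T carries the normalised mass
of f₀ to that of f₁. The inequality is then pointwise, from the hypothesis on g and the
arithmetic–geometric mean inequality for 1 and T'. -/
theorem prekopa_leindler_of_continuous {f₀ f₁ g : ℝ → ℝ} (h₀ : Continuous f₀) (h₁ : Continuous f₁)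
    (hg : Continuous g) {m : ℝ} (hm : 0 < m) (hm₀ : ∀ x, 0 < f₀ x) (hm₁ : ∀ x, m ≤ f₁ x)
    {l₀ u₀ l₁ u₁ : ℝ} (hlu₀ : l₀ < u₀) (hlu₁ : l₁ < u₁)
    (hg0 : ∀ x ∈ Set.Icc l₀ u₀, ∀ y ∈ Set.Icc l₁ u₁, 0 ≤ g (1 / 2 * x + 1 / 2 * y))
    (h : ∀ x ∈ Set.Icc l₀ u₀, ∀ y ∈ Set.Icc l₁ u₁,
      f₀ x * f₁ y ≤ g (1 / 2 * x + 1 / 2 * y) ^ 2) :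
    (∫ x in l₀..u₀, f₀ x) * (∫ x in l₁..u₁, f₁ x) ≤
      (∫ x in (1 / 2 * l₀ + 1 / 2 * l₁)..(1 / 2 * u₀ + 1 / 2 * u₁), g x) ^ 2 ∧
    (l₀ = l₁ → ∫ x in l₀..u₀, f₀ x = ∫ x in l₁..u₁, f₁ x →
      ∫ x in l₀..u₀, f₀ x =
        ∫ x in (1 / 2 * l₀ + 1 / 2 * l₁)..(1 / 2 * u₀ + 1 / 2 * u₁), g x →
      u₀ = u₁ ∧ ∀ x ∈ Set.Icc l₀ u₀, f₀ x = f₁ x ∧ f₀ x = g x) := by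
  have hm₁' : ∀ x, 0 < f₁ x := fun x => hm.trans_le (hm₁ x)
  set V₀ := ∫ x in l₀..u₀, f₀ x with hV₀
  set V₁ := ∫ x in l₁..u₁, f₁ x with hV₁
  have hV₀p : 0 < V₀ := intervalIntegral.intervalIntegral_pos_of_pos
    (h₀.intervalIntegrable _ _) hm₀ hlu₀
  have hV₁p : 0 < V₁ := intervalIntegral.intervalIntegral_pos_of_pos
    (h₁.intervalIntegrable _ _) hm₁' hlu₁
  set c := V₁ / V₀ with hc
  have hcp : 0 < c := div_pos hV₁p hV₀p
  obtain ⟨T, hTl, hTd, hTF⟩ := exists_transport h₀ h₁ hm hm₁ l₀ l₁ c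
  have hTu : T u₀ = u₁ := by
    refine eq_of_intervalIntegral_eq h₁ hm₁' (l := l₁) ?_
    rw [hTF, ← hV₀, ← hV₁, hc, div_mul_cancel₀ _ hV₀p.ne']
  have hTp : ∀ x, 0 < c * f₀ x / f₁ (T x) := fun x =>
    div_pos (mul_pos hcp (hm₀ x)) (hm₁' _)
  have hTm : StrictMono T := strictMono_of_hasDerivAt_pos hTd hTp
  have hTc : Continuous T := continuous_iff_continuousAt.mpr fun x => (hTd x).continuousAt
  have hTI : ∀ x ∈ Set.Icc l₀ u₀, T x ∈ Set.Icc l₁ u₁ := fun x hx => by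
    rw [← hTl, ← hTu]; exact ⟨hTm.monotone hx.1, hTm.monotone hx.2⟩
  have hT'c : Continuous fun x => c * f₀ x / f₁ (T x) :=
    (continuous_const.mul h₀).div (h₁.comp hTc) fun x => (hm₁' _).ne'
  set G : ℝ → ℝ := fun x => g (1 / 2 * x + 1 / 2 * T x) with hG
  have hGc : Continuous G := hg.comp (by fun_prop)
  set J : ℝ → ℝ := fun x => 1 / 2 + 1 / 2 * (c * f₀ x / f₁ (T x)) with hJ
  have hJc : Continuous J := continuous_const.add (continuous_const.mul hT'c)
  have hsub : ∫ x in (1 / 2 * l₀ + 1 / 2 * l₁)..(1 / 2 * u₀ + 1 / 2 * u₁), g x =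
      ∫ x in l₀..u₀, G x * J x := by
    have := intervalIntegral.integral_comp_mul_deriv (a := l₀) (b := u₀)
      (f := fun x => 1 / 2 * x + 1 / 2 * T x) (f' := J) (g := g)
      (fun x _ => by
        refine (((hasDerivAt_id x).const_mul (1 / 2)).add ((hTd x).const_mul (1 / 2))).congr_deriv ?_
        simp [hJ])
      hJc.continuousOn hg
    rw [hTl, hTu] at this
    exact this.symm
  set k := √c with hk
  have hk2 : k ^ 2 = c := Real.sq_sqrt hcp.le
  have hkp : 0 < k := Real.sqrt_pos.mpr hcp
  -- After squaring, k² f₀² = f₀ · f₁(T) · T', where f₀ · f₁(T) ≤ G² and T' ≤ ((1 + T')/2)² = J².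
  have hpt : ∀ x ∈ Set.Icc l₀ u₀, k * f₀ x ≤ G x * J x := by
    intro x hx
    have hGx : 0 ≤ G x := hg0 x hx _ (hTI x hx)
    have hJx : 0 ≤ J x := by
      have := (hTp x).le
      simp only [hJ]; positivity
    refine le_of_sq_le_sq ?_ (mul_nonneg hGx hJx)
    have h1 := h x hx _ (hTI x hx)
    have h2 : (k * f₀ x) ^ 2 = f₀ x * f₁ (T x) * (c * f₀ x / f₁ (T x)) := by
      rw [mul_pow, hk2]
      have := (hm₁' (T x)).ne'
      field_simp
    have h3 : c * f₀ x / f₁ (T x) ≤ J x ^ 2 := by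
      simp only [hJ]
      nlinarith [sq_nonneg (1 - c * f₀ x / f₁ (T x))]
    rw [h2, mul_pow]
    exact mul_le_mul h1 h3 (hTp x).le (sq_nonneg _)
  have hVg : k * V₀ ≤ ∫ x in l₀..u₀, G x * J x := by
    rw [hV₀, ← intervalIntegral.integral_const_mul]
    exact intervalIntegral.integral_mono_on hlu₀.le
      ((continuous_const.mul h₀).intervalIntegrable _ _) ((hGc.mul hJc).intervalIntegrable _ _) hpt
  rw [hsub]
  refine ⟨?_, fun hl hVV hVV' => ?_⟩
  · have : V₀ * V₁ = (k * V₀) ^ 2 := by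
      rw [mul_pow, hk2, hc]; field_simp
    rw [this]
    exact pow_le_pow_left₀ (mul_pos hkp hV₀p).le hVg 2
  · have hc1 : c = 1 := by rw [hc, ← hVV, div_self hV₀p.ne']
    have hk1 : k = 1 := by rw [hk, hc1, Real.sqrt_one]
    have heq : ∀ x ∈ Set.Icc l₀ u₀, f₀ x = G x * J x := by
      by_contra! hne
      obtain ⟨x, hx, hne⟩ := hne
      have h1 : ∀ x ∈ Set.Icc l₀ u₀, f₀ x ≤ G x * J x := fun x hx => by
        have := hpt x hx
        rwa [hk1, one_mul] at this
      have := intervalIntegral.integral_lt_integral_of_continuousOn_of_le_of_exists_lt hlu₀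
        h₀.continuousOn (hGc.mul hJc).continuousOn (fun x hx => h1 x (Set.Ioc_subset_Icc_self hx))
        ⟨x, hx, lt_of_le_of_ne (h1 x hx) hne⟩
      exact this.ne hVV'
    -- Equality makes a = f₀ x, b = f₁(T x) and w = G x satisfy 2ab = w(a + b); together with ab ≤
    -- w² this forces ab(a - b)² ≤ 0.
    have hab : ∀ x ∈ Set.Icc l₀ u₀, f₁ (T x) = f₀ x := by
      intro x hx
      have e1 := heq x hx
      have e2 := h x hx _ (hTI x hx)
      have ha := hm₀ x
      have hb := hm₁' (T x)
      change _ ≤ G x ^ 2 at e2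
      simp only [hJ, hc1, one_mul] at e1
      set a := f₀ x
      set b := f₁ (T x)
      set w := G x
      have e3 : 2 * a * b = w * (a + b) := by
        field_simp at e1
        linarith
      have e4 : a * b * (a - b) ^ 2 ≤ 0 := by
        have : a * b * (a + b) ^ 2 ≤ (2 * a * b) ^ 2 := by
          rw [e3, mul_pow]
          exact mul_le_mul_of_nonneg_right e2 (sq_nonneg _)
        nlinarith
      have e5 : (a - b) ^ 2 ≤ 0 := by
        by_contra! h5
        exact absurd e4 (not_le.mpr (mul_pos (mul_pos ha hb) h5))
      have : a - b = 0 := pow_eq_zero_iff two_ne_zero |>.mp (le_antisymm e5 (sq_nonneg _))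
      linarith
    -- The densities agree along T and c = 1, so T' = 1; the common left endpoint makes T the
    -- identity.
    have hTx : ∀ x ∈ Set.Icc l₀ u₀, T x = x := by
      intro x hx
      have h1 := intervalIntegral.integral_eq_sub_of_hasDerivAt (a := l₀) (b := x)
        (fun t _ => hTd t) (hT'c.intervalIntegrable _ _)
      have h2 : ∫ t in l₀..x, c * f₀ t / f₁ (T t) = ∫ t in l₀..x, (1 : ℝ) := by
        refine intervalIntegral.integral_congr fun t ht => ?_
        rw [Set.uIcc_of_le hx.1] at ht
        simp only [hab t ⟨ht.1, ht.2.trans hx.2⟩, hc1, one_mul]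
        exact div_self (hm₀ t).ne'
      rw [h2, hTl, intervalIntegral.integral_const, smul_eq_mul, mul_one] at h1
      linarith
    refine ⟨by rw [← hTu, hTx u₀ (Set.right_mem_Icc.mpr hlu₀.le)], fun x hx => ⟨?_, ?_⟩⟩
    · have := hab x hx
      rw [hTx x hx] at this
      exact this.symm
    · have h1 := heq x hx
      have h2 := hab x hx
      rw [hTx x hx] at h2
      simp only [hG, hJ, hTx x hx, hc1, one_mul, h2, div_self (hm₀ x).ne'] at h1
      rw [h1, ← add_mul]
      norm_num

/-- The transport map is built on the whole line. Extending by the endpoint values preserves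
continuity and the positive minimum. -/
theorem exists_continuous_extension {f : ℝ → ℝ} {l u : ℝ} (hlu : l ≤ u)
    (hf : ContinuousOn f (Set.Icc l u)) (hpos : ∀ x ∈ Set.Icc l u, 0 < f x) :
    ∃ F : ℝ → ℝ, Continuous F ∧ (∃ m > 0, ∀ x, m ≤ F x) ∧ Set.EqOn F f (Set.Icc l u) := by
  obtain ⟨x₀, hx₀, hmin⟩ := isCompact_Icc.exists_isMinOn (Set.nonempty_Icc.mpr hlu) hf
  refine ⟨Set.IccExtend hlu ((Set.Icc l u).domRestrict f), hf.domRestrict.Icc_extend',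
    ⟨f x₀, hpos x₀ hx₀, fun x => ?_⟩, fun x hx => ?_⟩
  · exact hmin (Set.projIcc l u hlu x).2
  · rw [Set.IccExtend_of_mem hlu _ hx]; rfl

theorem prekopa_leindler {f₀ f₁ g : ℝ → ℝ} {l₀ u₀ l₁ u₁ : ℝ} (hlu₀ : l₀ < u₀) (hlu₁ : l₁ < u₁)
    (h₀ : ContinuousOn f₀ (Set.Icc l₀ u₀)) (h₁ : ContinuousOn f₁ (Set.Icc l₁ u₁))
    (hg : ContinuousOn g (Set.Icc (1 / 2 * l₀ + 1 / 2 * l₁) (1 / 2 * u₀ + 1 / 2 * u₁)))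
    (hp₀ : ∀ x ∈ Set.Icc l₀ u₀, 0 < f₀ x) (hp₁ : ∀ x ∈ Set.Icc l₁ u₁, 0 < f₁ x)
    (hpg : ∀ x ∈ Set.Icc (1 / 2 * l₀ + 1 / 2 * l₁) (1 / 2 * u₀ + 1 / 2 * u₁), 0 < g x)
    (h : ∀ x ∈ Set.Icc l₀ u₀, ∀ y ∈ Set.Icc l₁ u₁,
      f₀ x * f₁ y ≤ g (1 / 2 * x + 1 / 2 * y) ^ 2) :
    (∫ x in l₀..u₀, f₀ x) * (∫ x in l₁..u₁, f₁ x) ≤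
      (∫ x in (1 / 2 * l₀ + 1 / 2 * l₁)..(1 / 2 * u₀ + 1 / 2 * u₁), g x) ^ 2 ∧
    (l₀ = l₁ → ∫ x in l₀..u₀, f₀ x = ∫ x in l₁..u₁, f₁ x →
      ∫ x in l₀..u₀, f₀ x =
        ∫ x in (1 / 2 * l₀ + 1 / 2 * l₁)..(1 / 2 * u₀ + 1 / 2 * u₁), g x →
      u₀ = u₁ ∧ ∀ x ∈ Set.Icc l₀ u₀, f₀ x = f₁ x ∧ f₀ x = g x) := by
  have hlu : 1 / 2 * l₀ + 1 / 2 * l₁ < 1 / 2 * u₀ + 1 / 2 * u₁ := by linarith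
  obtain ⟨F₀, hF₀, ⟨m₀, hm₀, hm₀'⟩, he₀⟩ := exists_continuous_extension hlu₀.le h₀ hp₀
  obtain ⟨F₁, hF₁, ⟨m₁, hm₁, hm₁'⟩, he₁⟩ := exists_continuous_extension hlu₁.le h₁ hp₁
  obtain ⟨Fg, hFg, ⟨mg, hmg, hmg'⟩, heg⟩ := exists_continuous_extension hlu.le hg hpg
  have hmid : ∀ x ∈ Set.Icc l₀ u₀, ∀ y ∈ Set.Icc l₁ u₁, 1 / 2 * x + 1 / 2 * y ∈
      Set.Icc (1 / 2 * l₀ + 1 / 2 * l₁) (1 / 2 * u₀ + 1 / 2 * u₁) := fun x hx y hy =>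
    ⟨by linarith [hx.1, hy.1], by linarith [hx.2, hy.2]⟩
  have key := prekopa_leindler_of_continuous hF₀ hF₁ hFg hm₁ (fun x => hm₀.trans_le (hm₀' x)) hm₁'
    hlu₀ hlu₁ (fun x hx y hy => (hmg.trans_le (hmg' _)).le) (fun x hx y hy => by
      rw [he₀ hx, he₁ hy, heg (hmid x hx y hy)]; exact h x hx y hy)
  rw [intervalIntegral.integral_congr (f := F₀) (g := f₀) (by rwa [Set.uIcc_of_le hlu₀.le]),
    intervalIntegral.integral_congr (f := F₁) (g := f₁) (by rwa [Set.uIcc_of_le hlu₁.le]),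
    intervalIntegral.integral_congr (f := Fg) (g := g) (by rwa [Set.uIcc_of_le hlu.le])] at key
  refine ⟨key.1, fun hl hV hV' => ?_⟩
  obtain ⟨hu, hx⟩ := key.2 hl hV hV'
  refine ⟨hu, fun x hx' => ?_⟩
  have h1 := hx x hx'
  have h2 : x ∈ Set.Icc l₁ u₁ := by rwa [← hl, ← hu]
  have h3 := hmid x hx' x h2
  rw [show 1 / 2 * x + 1 / 2 * x = x by ring] at h3
  rwa [he₀ hx', he₁ h2, heg h3] at h1

namespace BottMatrix

theorem IsKahlerClass.midpoint {n : ℕ} {A : BottMatrix n} {b b' : Fin n → Fin 2 → ℝ}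
    (hb : A.IsKahlerClass b) (hb' : A.IsKahlerClass b') :
    A.IsKahlerClass ((1 / 2 : ℝ) • b + (1 / 2 : ℝ) • b') :=
  A.convex_isKahlerClass hb hb' (by norm_num) (by norm_num) (by norm_num)

/-- The slice of the averaged polytope at an averaged height has the averaged slice coefficients, so
the inequality in one dimension less is precisely the pointwise hypothesis of Prékopa–Leindler for
slice volumes. -/
theorem prekopa_leindler_vol {n : ℕ} {A : BottMatrix (n + 1)} {b b' : Fin (n + 1) → Fin 2 → ℝ}
    (hb : A.IsKahlerClass b) (hb' : A.IsKahlerClass b')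
    (ih : ∀ {c c' : Fin n → Fin 2 → ℝ}, A.truncate.IsKahlerClass c → A.truncate.IsKahlerClass c' →
      A.truncate.vol c * A.truncate.vol c' ≤
        A.truncate.vol ((1 / 2 : ℝ) • c + (1 / 2 : ℝ) • c') ^ 2) :
    A.vol b * A.vol b' ≤ A.vol ((1 / 2 : ℝ) • b + (1 / 2 : ℝ) • b') ^ 2 ∧
    (b (Fin.last n) 1 = b' (Fin.last n) 1 → A.vol b = A.vol b' →
      A.vol b = A.vol ((1 / 2 : ℝ) • b + (1 / 2 : ℝ) • b') →
      b (Fin.last n) 0 = b' (Fin.last n) 0 ∧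
        ∀ x ∈ Set.Icc (-b (Fin.last n) 1) (b (Fin.last n) 0),
          A.truncate.vol (A.sliceCoeff b x) = A.truncate.vol (A.sliceCoeff b' x) ∧
          A.truncate.vol (A.sliceCoeff b x) =
            A.truncate.vol (A.sliceCoeff ((1 / 2 : ℝ) • b + (1 / 2 : ℝ) • b') x)) := by
  have hm := hb.midpoint hb'
  have hl : -((1 / 2 : ℝ) • b + (1 / 2 : ℝ) • b') (Fin.last n) 1 =
      1 / 2 * (-b (Fin.last n) 1) + 1 / 2 * (-b' (Fin.last n) 1) := by
    simp only [Pi.add_apply, Pi.smul_apply, smul_eq_mul]; ring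
  have hu : ((1 / 2 : ℝ) • b + (1 / 2 : ℝ) • b') (Fin.last n) 0 =
      1 / 2 * b (Fin.last n) 0 + 1 / 2 * b' (Fin.last n) 0 := rfl
  have hc := hm.continuousOn_vol_sliceCoeff
  have hp := fun x (hx : x ∈ Set.Icc _ _) => (hm.sliceCoeff (z := x) hx).vol_pos
  rw [A.vol_eq_integral hb.lt.le, A.vol_eq_integral hb'.lt.le, A.vol_eq_integral hm.lt.le]
  rw [hl, hu] at hc hp ⊢
  have key := prekopa_leindler hb.lt hb'.lt hb.continuousOn_vol_sliceCoeff
    hb'.continuousOn_vol_sliceCoeff hc (fun x hx => (hb.sliceCoeff hx).vol_pos)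
    (fun x hx => (hb'.sliceCoeff hx).vol_pos) hp (fun x hx y hy => by
      rw [sliceCoeff_combo]
      exact ih (hb.sliceCoeff hx) (hb'.sliceCoeff hy))
  exact ⟨key.1, fun h1 => key.2 (congrArg Neg.neg h1)⟩

/-- A case of the Brunn–Minkowski inequality. -/
theorem IsKahlerClass.vol_mul_vol_le {n : ℕ} {A : BottMatrix n} {b b' : Fin n → Fin 2 → ℝ}
    (hb : A.IsKahlerClass b) (hb' : A.IsKahlerClass b') :
    A.vol b * A.vol b' ≤ A.vol ((1 / 2 : ℝ) • b + (1 / 2 : ℝ) • b') ^ 2 := by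
  induction n with
  | zero => simp [vol_zero]
  | succ n ih => exact (prekopa_leindler_vol hb hb' ih).1

/-- The case of equality in the Brunn–Minkowski inequality. -/
theorem IsKahlerClass.eq_of_vol_eq {n : ℕ} {A : BottMatrix n} {b b' : Fin n → Fin 2 → ℝ}
    (hb : A.IsKahlerClass b) (hb' : A.IsKahlerClass b') (h1 : ∀ i, b i 1 = b' i 1)
    (hV : A.vol b = A.vol b') (hV' : A.vol b = A.vol ((1 / 2 : ℝ) • b + (1 / 2 : ℝ) • b')) :
    b = b' := by
  induction n with
  | zero => exact Subsingleton.elim _ _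
  | succ n ih =>
    obtain ⟨hu, hx⟩ := (prekopa_leindler_vol hb hb' IsKahlerClass.vol_mul_vol_le).2
      (h1 (Fin.last n)) hV hV'
    -- One height suffices: equal slice coefficients there, together with the now equal heights,
    -- determine all the coefficients. The bottom is convenient because `h1` makes it common to both
    -- polytopes.
    have hmem : -b (Fin.last n) 1 ∈ Set.Icc (-b (Fin.last n) 1) (b (Fin.last n) 0) :=
      Set.left_mem_Icc.mpr hb.lt.le
    have hmem' : -b (Fin.last n) 1 ∈ Set.Icc (-b' (Fin.last n) 1) (b' (Fin.last n) 0) := by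
      rwa [← hu, ← h1]
    obtain ⟨hx1, hx2⟩ := hx _ hmem
    have hs := A.sliceCoeff_combo b b' (-b (Fin.last n) 1) (-b (Fin.last n) 1) (1 / 2) (1 / 2)
    rw [show 1 / 2 * -b (Fin.last n) 1 + 1 / 2 * -b (Fin.last n) 1 = -b (Fin.last n) 1 by ring]
      at hs
    rw [hs] at hx2
    have heq := ih (hb.sliceCoeff hmem) (hb'.sliceCoeff hmem')
      (fun i => by simp only [BottMatrix.sliceCoeff, h1]) hx1 hx2
    funext i δ
    refine Fin.lastCases ?_ (fun i => ?_) i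
    · have hδ : δ = 0 ∨ δ = 1 := by revert δ; decide
      rcases hδ with rfl | rfl
      · exact hu
      · exact h1 _
    · have := congrFun (congrFun heq i) δ
      simpa [BottMatrix.sliceCoeff] using this

end BottMatrix

end

/-! ### Slabs of a pillar, their Futaki invariants and rigidity. -/

noncomputable section

open MeasureTheory

theorem slabCoeff_castSucc {n : ℕ} (a : Fin n → Fin 2 → ℝ) (s : ℝ) (i : Fin n) :
    slabCoeff a s i.castSucc = a i :=
  Fin.snoc_castSucc (α := fun _ => Fin 2 → ℝ) _ _ _

theorem slabCoeff_last_zero {n : ℕ} (a : Fin n → Fin 2 → ℝ) (s : ℝ) :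
    slabCoeff a s (Fin.last n) 0 = s := by
  simp [slabCoeff]

theorem slabCoeff_last_one {n : ℕ} (a : Fin n → Fin 2 → ℝ) (s : ℝ) :
    slabCoeff a s (Fin.last n) 1 = 0 := by
  simp [slabCoeff]

namespace BottMatrix

/-- The coefficients of the slice of a pillar at the height `t`. -/
def pillarCoeff {n : ℕ} (A : BottMatrix (n + 1)) (a : Fin n → Fin 2 → ℝ) (t : ℝ) :
    Fin n → Fin 2 → ℝ :=
  fun i δ => a i δ + t * (A.ray i.castSucc δ (Fin.last n) : ℝ)

theorem sliceCoeff_slabCoeff {n : ℕ} (A : BottMatrix (n + 1)) (a : Fin n → Fin 2 → ℝ) (s t : ℝ) :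
    A.sliceCoeff (slabCoeff a s) t = A.pillarCoeff a t := by
  funext i δ
  rw [sliceCoeff, slabCoeff_castSucc, pillarCoeff]

theorem pillarCoeff_zero {n : ℕ} (A : BottMatrix (n + 1)) (a : Fin n → Fin 2 → ℝ) :
    A.pillarCoeff a 0 = a := by
  funext i δ
  rw [pillarCoeff, zero_mul, add_zero]

theorem isKahlerClass_slabCoeff_iff {n : ℕ} (A : BottMatrix (n + 1)) (a : Fin n → Fin 2 → ℝ)
    (s : ℝ) : A.IsKahlerClass (slabCoeff a s) ↔
      0 < s ∧ A.truncate.IsKahlerClass a ∧ A.truncate.IsKahlerClass (A.pillarCoeff a s) := by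
  rw [isKahlerClass_iff, slabCoeff_last_one, slabCoeff_last_zero, sliceCoeff_slabCoeff,
    sliceCoeff_slabCoeff, neg_zero, pillarCoeff_zero]

section Slab

variable {k : ℕ} (A : BottMatrix (k + 2)) (a : Fin (k + 1) → Fin 2 → ℝ) {s : ℝ}

theorem slab_le (hs : 0 ≤ s) :
    -slabCoeff a s (Fin.last (k + 1)) 1 ≤ slabCoeff a s (Fin.last (k + 1)) 0 := by
  rwa [slabCoeff_last_one, slabCoeff_last_zero, neg_zero]

theorem setIntegral_slab (hs : 0 ≤ s) {h : (Fin (k + 2) → ℝ) → ℝ} (hh : Continuous h) :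
    ∫ x in A.polytope (slabCoeff a s), h x =
      ∫ z in 0..s, ∫ y in A.truncate.polytope (A.pillarCoeff a z), h (joinLast y z) := by
  have := A.setIntegral_polytope (slab_le a hs) hh
  simpa only [slabCoeff_last_one, slabCoeff_last_zero, sliceCoeff_slabCoeff, neg_zero] using this

theorem integral_boundary_slab (hs : 0 ≤ s) {h : (Fin (k + 2) → ℝ) → ℝ} (hh : Continuous h) :
    ∫ x, h x ∂(A.boundaryMeasure (slabCoeff a s)) =
      (∫ y in A.truncate.polytope (A.pillarCoeff a s), h (joinLast y s)) +
      (∫ y in A.truncate.polytope (A.pillarCoeff a 0), h (joinLast y 0)) +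
      ∫ z in 0..s, ∫ y, h (joinLast y z) ∂(A.truncate.boundaryMeasure (A.pillarCoeff a z)) := by
  have := A.integral_boundaryMeasure_succ (slab_le a hs) hh
  simpa only [slabCoeff_last_one, slabCoeff_last_zero, sliceCoeff_slabCoeff, neg_zero] using this

theorem vol_slab (hs : 0 ≤ s) :
    A.vol (slabCoeff a s) = ∫ z in 0..s, A.truncate.vol (A.pillarCoeff a z) := by
  have := A.vol_eq_integral (slab_le a hs)
  simpa only [slabCoeff_last_one, slabCoeff_last_zero, sliceCoeff_slabCoeff, neg_zero] using this

theorem boundaryMass_slab (hs : 0 ≤ s) :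
    A.boundaryMass (slabCoeff a s) = A.truncate.vol (A.pillarCoeff a s) +
      A.truncate.vol (A.pillarCoeff a 0) +
      ∫ z in 0..s, A.truncate.boundaryMass (A.pillarCoeff a z) := by
  have := A.boundaryMass_eq (slab_le a hs)
  simpa only [slabCoeff_last_one, slabCoeff_last_zero, sliceCoeff_slabCoeff, neg_zero] using this

/-- On each slice the height is constant, so only slice volumes and boundary masses enter; the
bottom facet has height 0 and contributes no moment. -/
theorem futaki_slab_last (hs : 0 ≤ s) :
    A.futaki (slabCoeff a s) (fun x => x (Fin.last (k + 1))) =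
      (∫ z in 0..s, A.truncate.vol (A.pillarCoeff a z)) *
        (s * A.truncate.vol (A.pillarCoeff a s) +
          ∫ z in 0..s, z * A.truncate.boundaryMass (A.pillarCoeff a z)) -
      (A.truncate.vol (A.pillarCoeff a s) + A.truncate.vol (A.pillarCoeff a 0) +
        ∫ z in 0..s, A.truncate.boundaryMass (A.pillarCoeff a z)) *
        ∫ z in 0..s, z * A.truncate.vol (A.pillarCoeff a z) := by
  have hc : Continuous fun x : Fin (k + 2) → ℝ => x (Fin.last (k + 1)) := continuous_apply _
  change A.vol _ * _ - A.boundaryMass _ * _ = _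
  rw [vol_slab A a hs, boundaryMass_slab A a hs, setIntegral_slab A a hs hc,
    integral_boundary_slab A a hs hc]
  simp only [Fin.snoc_last, setIntegral_const_polytope, integral_const_boundaryMeasure, zero_mul,
    add_zero, mul_comm _ s, fun z => mul_comm (A.truncate.vol (A.pillarCoeff a z)) z,
    fun z => mul_comm (A.truncate.boundaryMass (A.pillarCoeff a z)) z]

/-- If the Futaki invariants of the slabs vanish, then the pillar is a prism. -/
theorem last_row_eq_zero (hK : ∃ s : ℝ, A.IsKahlerClass (slabCoeff a s))
    (hF : ∀ s : ℝ, 0 < s → A.IsKahlerClass (slabCoeff a s) →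
      A.futaki (slabCoeff a s) (fun x => x (Fin.last (k + 1))) = 0) (i : Fin (k + 1)) :
    A.a (Fin.last (k + 1)) i.castSucc = 0 := by
  obtain ⟨s, hs⟩ := hK
  obtain ⟨hs0, ha, has⟩ := (A.isKahlerClass_slabCoeff_iff a s).mp hs
  have hp : ∀ t ∈ Set.Icc 0 s, A.truncate.IsKahlerClass (A.pillarCoeff a t) := fun t ht => by
    rw [← A.sliceCoeff_slabCoeff a s]
    refine hs.sliceCoeff ?_
    rwa [slabCoeff_last_one, slabCoeff_last_zero, neg_zero]
  obtain ⟨p, hpv⟩ := A.truncate.exists_eval_eq_vol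
  obtain ⟨q, hq⟩ := A.exists_eval_eq_sliceCoeff p
  obtain ⟨p', hpb⟩ := A.truncate.exists_eval_eq_boundaryMass
  obtain ⟨q', hq'⟩ := A.exists_eval_eq_sliceCoeff p'
  set V := q.map (MvPolynomial.eval (Function.uncurry (slabCoeff a s))) with hV
  set B := q'.map (MvPolynomial.eval (Function.uncurry (slabCoeff a s))) with hB
  have hVt : ∀ t ∈ Set.Icc 0 s, A.truncate.vol (A.pillarCoeff a t) = V.eval t := fun t ht => by
    rw [hpv _ (hp t ht), ← A.sliceCoeff_slabCoeff a s, hq]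
  have hBt : ∀ t ∈ Set.Icc 0 s, A.truncate.boundaryMass (A.pillarCoeff a t) = B.eval t :=
    fun t ht => by
      rw [hpb _ (hp t ht), ← A.sliceCoeff_slabCoeff a s, hq']
  have h0 : (0 : ℝ) ∈ Set.Icc 0 s := Set.left_mem_Icc.mpr hs0.le
  -- Every slab of height t in (0, s] is again Kähler, since its end slices are; so the Futaki
  -- hypothesis holds on a whole interval.
  have hconst : V = Polynomial.C (V.eval 0) := by
    refine Polynomial.eq_C_of_futaki_eq_zero (B := B) hs0 ?_ fun t ht => ?_
    · rw [← hVt 0 h0]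
      exact (hp 0 h0).vol_pos.ne'
    · have htI : t ∈ Set.Icc 0 s := Set.Ioc_subset_Icc_self ht
      have hF' := hF t ht.1 ((A.isKahlerClass_slabCoeff_iff a t).mpr ⟨ht.1, ha, hp t htI⟩)
      have hsub : ∀ z ∈ Set.uIcc 0 t, z ∈ Set.Icc 0 s := fun z hz => by
        rw [Set.uIcc_of_le ht.1.le] at hz
        exact ⟨hz.1, hz.2.trans ht.2⟩
      rw [futaki_slab_last A a ht.1.le, hVt t htI, hVt 0 h0,
        intervalIntegral.integral_congr fun z hz => hVt z (hsub z hz),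
        intervalIntegral.integral_congr fun z hz => hBt z (hsub z hz),
        intervalIntegral.integral_congr (f := fun z => z * A.truncate.vol (A.pillarCoeff a z))
          fun z hz => congrArg (z * ·) (hVt z (hsub z hz)),
        intervalIntegral.integral_congr
          (f := fun z => z * A.truncate.boundaryMass (A.pillarCoeff a z))
          fun z hz => congrArg (z * ·) (hBt z (hsub z hz))] at hF'
      exact hF'
  have hvol : ∀ t ∈ Set.Icc 0 s, A.truncate.vol (A.pillarCoeff a t) = V.eval 0 := fun t ht => by
    rw [hVt t ht, hconst, Polynomial.eval_C, Polynomial.eval_C]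
  have hs1 : s ∈ Set.Icc 0 s := Set.right_mem_Icc.mpr hs0.le
  have hmid : (1 / 2 : ℝ) • A.pillarCoeff a 0 + (1 / 2 : ℝ) • A.pillarCoeff a s =
      A.pillarCoeff a (s / 2) := by
    funext i δ
    simp only [pillarCoeff, Pi.add_apply, Pi.smul_apply, smul_eq_mul]; ring
  -- The rays e_i with i < n have last entry 0, so their coefficients are the same at all heights,
  -- which is the normalisation that excludes translations.
  have heq := (hp 0 h0).eq_of_vol_eq (hp s hs1)
    (fun i => by simp only [pillarCoeff, ray_one, (Fin.castSucc_lt_last i).ne', if_false,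
      Int.cast_zero, mul_zero])
    (by rw [hvol 0 h0, hvol s hs1])
    (by rw [hmid, hvol 0 h0, hvol (s / 2) ⟨by linarith, by linarith⟩])
  have := congrFun (congrFun heq i) 0
  simp only [pillarCoeff, ray_zero, zero_mul, add_zero] at this
  have h2 : s * ((-A.a (Fin.last (k + 1)) i.castSucc : ℤ) : ℝ) = 0 := by linarith
  have h3 := (mul_eq_zero.mp h2).resolve_left hs0.ne'
  have h4 : -A.a (Fin.last (k + 1)) i.castSucc = 0 := by exact_mod_cast h3
  exact neg_eq_zero.mp h4

end Slab

/-! ### Polytopes and Futaki invariants when the last row is trivial. -/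

theorem ray_castSucc_last_eq_zero {n : ℕ} {A : BottMatrix (n + 1)}
    (h0 : ∀ i : Fin n, A.a (Fin.last n) i.castSucc = 0) (i : Fin n) (δ : Fin 2) :
    A.ray i.castSucc δ (Fin.last n) = 0 := by
  have hδ : δ = 0 ∨ δ = 1 := by revert δ; decide
  rcases hδ with rfl | rfl
  · rw [ray_zero, h0, neg_zero]
  · rw [ray_one, if_neg (Fin.castSucc_lt_last i).ne']

theorem pillarCoeff_eq {n : ℕ} {A : BottMatrix (n + 1)}
    (h0 : ∀ i : Fin n, A.a (Fin.last n) i.castSucc = 0)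
    (a : Fin n → Fin 2 → ℝ) (t : ℝ) : A.pillarCoeff a t = a := by
  funext i δ
  rw [pillarCoeff, ray_castSucc_last_eq_zero h0, Int.cast_zero, mul_zero, add_zero]

theorem polytope_slabCoeff_eq {n : ℕ} {A : BottMatrix (n + 1)}
    (h0 : ∀ i : Fin n, A.a (Fin.last n) i.castSucc = 0)
    (a : Fin n → Fin 2 → ℝ) (s : ℝ) : A.polytope (slabCoeff a s) =
    {x | (fun i : Fin n => x i.castSucc) ∈ A.truncate.polytope a ∧
      x (Fin.last n) ∈ Set.Icc 0 s} := by
  ext x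
  conv_lhs => rw [← joinLast_init_last x]
  rw [joinLast_mem_polytope, sliceCoeff_slabCoeff, pillarCoeff_eq h0, slabCoeff_last_one,
    slabCoeff_last_zero, neg_zero]
  exact and_comm

theorem isKahlerClass_slabCoeff {n : ℕ} {A : BottMatrix (n + 1)}
    (h0 : ∀ i : Fin n, A.a (Fin.last n) i.castSucc = 0)
    {a : Fin n → Fin 2 → ℝ} (ha : A.truncate.IsKahlerClass a) {s : ℝ}
    (hs : 0 < s) : A.IsKahlerClass (slabCoeff a s) := by
  rw [isKahlerClass_slabCoeff_iff, pillarCoeff_eq h0]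
  exact ⟨hs, ha, ha⟩

/-- All slices coincide, so volume and moment carry a factor s. The end facets add to the boundary
mass and to the boundary moment twice the volume and twice the moment of the slice, and these
contributions cancel. -/
theorem futaki_slab_castSucc {k : ℕ} {A : BottMatrix (k + 2)}
    (h0 : ∀ i : Fin (k + 1), A.a (Fin.last (k + 1)) i.castSucc = 0)
    (a : Fin (k + 1) → Fin 2 → ℝ) {s : ℝ} (hs : 0 ≤ s) (i : Fin (k + 1)) :
    A.futaki (slabCoeff a s) (fun x => x i.castSucc) =
      s ^ 2 * A.truncate.futaki a (fun y => y i) := by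
  have hc : Continuous fun x : Fin (k + 2) → ℝ => x i.castSucc := continuous_apply _
  change A.vol _ * _ - A.boundaryMass _ * _ =
    s ^ 2 * (A.truncate.vol _ * _ - A.truncate.boundaryMass _ * _)
  rw [vol_slab A a hs, boundaryMass_slab A a hs, setIntegral_slab A a hs hc,
    integral_boundary_slab A a hs hc]
  simp only [Fin.snoc_castSucc, pillarCoeff_eq h0, intervalIntegral.integral_const, smul_eq_mul,
    sub_zero]
  ring

end BottMatrix

end

/-! ### Cones, ray generators and primitive collections. -/

noncomputable section

theorem mem_latticeCone_image_iff {n : ℕ} {ι : Type*} [Fintype ι] (r : ι → Fin n → ℤ) (S : Set ι)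
    (x : Fin n → ℝ) : x ∈ latticeCone (r '' S) ↔
      ∃ w : ι → ℝ, (∀ i, 0 ≤ w i) ∧ (∀ i, i ∉ S → w i = 0) ∧ ∀ j, x j = ∑ i, w i * (r i j : ℝ) := by
  classical
  constructor
  · intro hx
    refine Submodule.span_induction ?_ ?_ ?_ ?_ hx
    · rintro _ ⟨_, ⟨i, hi, rfl⟩, rfl⟩
      refine ⟨Pi.single i 1, fun j => ?_, fun j hj => ?_, fun j => ?_⟩
      · rw [Pi.single_apply]; split_ifs <;> norm_num
      · exact Pi.single_eq_of_ne (fun h : j = i => hj (h ▸ hi)) _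
      · simp [Pi.single_apply]
    · exact ⟨0, fun _ => le_rfl, fun _ _ => rfl, fun j => by simp⟩
    · rintro x y - - ⟨w, hw, hw', hwx⟩ ⟨v, hv, hv', hvy⟩
      refine ⟨w + v, fun i => add_nonneg (hw i) (hv i), fun i hi => ?_, fun j => ?_⟩
      · rw [Pi.add_apply, hw' i hi, hv' i hi, add_zero]
      · simp only [Pi.add_apply, hwx j, hvy j, add_mul, Finset.sum_add_distrib]
    · rintro c x - ⟨w, hw, hw', hwx⟩
      refine ⟨fun i => c * w i, fun i => mul_nonneg c.2 (hw i), fun i hi => ?_, fun j => ?_⟩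
      · simp only [hw' i hi, mul_zero]
      · change (c : ℝ) * x j = _
        rw [hwx j, Finset.mul_sum]
        exact Finset.sum_congr rfl fun i _ => (mul_assoc _ _ _).symm
  · rintro ⟨w, hw, hw', hx⟩
    have : x = ∑ i, (⟨w i, hw i⟩ : {c : ℝ // 0 ≤ c}) • fun j => (r i j : ℝ) := by
      funext j
      rw [hx j, Finset.sum_apply]
      rfl
    rw [this]
    refine Submodule.sum_mem _ fun i _ => ?_
    by_cases hi : i ∈ S
    · exact Submodule.smul_mem _ _ (Submodule.subset_span ⟨_, ⟨i, hi, rfl⟩, rfl⟩)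
    · have h0 : (⟨w i, hw i⟩ : {c : ℝ // 0 ≤ c}) = 0 := Subtype.ext (hw' i hi)
      rw [h0, zero_smul]
      exact Submodule.zero_mem _

theorem mem_latticeCone_of_mem {n : ℕ} {R : Set (Fin n → ℤ)} {v : Fin n → ℤ} (h : v ∈ R) :
    (fun j => (v j : ℝ)) ∈ latticeCone R :=
  Submodule.subset_span ⟨v, h, rfl⟩

theorem mem_latticeCone_singleton_iff {n : ℕ} (v : Fin n → ℤ) (x : Fin n → ℝ) :
    x ∈ latticeCone {v} ↔ ∃ μ : ℝ, 0 ≤ μ ∧ ∀ j, x j = μ * (v j : ℝ) := by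
  have h : ({v} : Set (Fin n → ℤ)) = (fun _ : Unit => v) '' Set.univ := by simp
  rw [h, mem_latticeCone_image_iff]
  constructor
  · rintro ⟨w, hw, -, hx⟩
    exact ⟨w (), hw (), fun j => by simpa using hx j⟩
  · rintro ⟨μ, hμ, hx⟩
    exact ⟨fun _ => μ, fun _ => hμ, fun i hi => absurd (Set.mem_univ i) hi,
      fun j => by simpa using hx j⟩

namespace BottMatrix

theorem ray_mul_self {n : ℕ} (A : BottMatrix n) (i : Fin n) (δ : Fin 2) :
    A.ray i δ i * A.ray i δ i = 1 := by
  rw [ray_diag]; split_ifs <;> norm_num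

/-- Read the coordinates in increasing order. By triangularity the weights below `i` vanish one
after another; the coordinate `i` then compares two signs with a nonnegative weight, so the signs
agree and the weight is nonzero. -/
theorem of_ray_mem_latticeCone {n : ℕ} (A : BottMatrix n) {S : Set (Fin n)} {c : Fin n → Fin 2}
    {i : Fin n} {δ : Fin 2}
    (h : (fun j => (A.ray i δ j : ℝ)) ∈ latticeCone ((fun i => A.ray i (c i)) '' S)) :
    i ∈ S ∧ c i = δ := by
  obtain ⟨w, hw, hw', hx⟩ := (mem_latticeCone_image_iff _ S _).mp h
  have hdiag : ∀ j, (∀ m < j, w m = 0) → (A.ray i δ j : ℝ) = w j * (A.ray j (c j) j : ℝ) := by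
    intro j hj
    rw [hx j, Finset.sum_eq_single j]
    · intro m _ hm
      rcases lt_or_gt_of_ne hm with hlt | hlt
      · rw [hj m hlt, zero_mul]
      · rw [A.ray_of_lt hlt, Int.cast_zero, mul_zero]
    · exact fun hj => absurd (Finset.mem_univ j) hj
  have hne : ∀ j, (A.ray j (c j) j : ℝ) ≠ 0 := fun j h0 => by
    have := A.abs_ray_diag j (c j)
    rw [h0, abs_zero] at this
    exact zero_ne_one this
  have hzero : ∀ j < i, w j = 0 := by
    intro j
    induction j using WellFoundedLT.induction with
    | ind j ih =>
      intro hj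
      have := hdiag j fun m hm => ih m hm (hm.trans hj)
      rw [A.ray_of_lt hj, Int.cast_zero] at this
      exact (mul_eq_zero.mp this.symm).resolve_right (hne j)
  have hi := hdiag i hzero
  refine ⟨?_, ?_⟩
  · by_contra hi'
    rw [hw' i hi', zero_mul] at hi
    have := A.abs_ray_diag i δ
    rw [hi, abs_zero] at this
    exact zero_ne_one this
  · have hδ : ∀ ε : Fin 2, ε = 0 ∨ ε = 1 := by decide
    have := hw i
    rw [ray_diag, ray_diag] at hi
    rcases hδ (c i) with h1 | h1 <;> rcases hδ δ with h2 | h2 <;> rw [h1, h2] at hi ⊢ <;>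
      exfalso <;> norm_num at hi <;> linarith

theorem ray_ne {n : ℕ} (A : BottMatrix n) (i : Fin n) : A.ray i 0 ≠ A.ray i 1 := by
  intro h
  have := congrFun h i
  rw [ray_diag, ray_diag] at this
  norm_num at this

theorem isPrimitiveVector_ray {n : ℕ} (A : BottMatrix n) (i : Fin n) (δ : Fin 2) :
    IsPrimitiveVector (A.ray i δ) := by
  intro k w h
  have h1 := congrFun h i
  have h2 := A.ray_mul_self i δ
  rw [h1, Pi.smul_apply, smul_eq_mul] at h2
  exact IsUnit.of_mul_eq_one (w i * (k * w i)) (by rw [← h2]; ring)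

theorem latticeCone_ray_mem_fan {n : ℕ} (A : BottMatrix n) (i : Fin n) (δ : Fin 2) :
    latticeCone {A.ray i δ} ∈ A.fan :=
  ⟨{i}, fun _ => δ, by rw [Set.image_singleton]⟩

theorem fanGenerators_fan {n : ℕ} (A : BottMatrix n) :
    fanGenerators A.fan = {v | ∃ i δ, v = A.ray i δ} := by
  ext v
  constructor
  · rintro ⟨hv, S, c, hS⟩
    rcases S.eq_empty_or_nonempty with rfl | ⟨i, hi⟩
    · exfalso
      have h1 := mem_latticeCone_of_mem (Set.mem_singleton v)
      rw [hS, mem_latticeCone_image_iff] at h1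
      obtain ⟨w, -, hw, hx⟩ := h1
      have hv0 : v = (0 : ℤ) • (0 : Fin n → ℤ) := by
        funext j
        have := hx j
        rw [Finset.sum_eq_zero fun i _ => by rw [hw i (Set.notMem_empty i), zero_mul]] at this
        simpa using this
      exact not_isUnit_zero (hv 0 0 hv0)
    -- Any generator of the cone is a nonnegative multiple of v. Its diagonal entry ε = ±1 makes v
    -- an integer multiple of that generator, primitivity makes the factor ±1, and nonnegativity of
    -- μ excludes -1.
    · have h1 : (fun j => (A.ray i (c i) j : ℝ)) ∈ latticeCone {v} := by
        rw [hS]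
        exact mem_latticeCone_of_mem ⟨i, hi, rfl⟩
      obtain ⟨μ, hμ, hx⟩ := (mem_latticeCone_singleton_iff v _).mp h1
      set ε := A.ray i (c i) i with hε
      have hε2 : (ε : ℝ) * ε = 1 := by exact_mod_cast A.ray_mul_self i (c i)
      have hεi : (ε : ℝ) = μ * v i := hx i
      have hv' : v = (ε * v i) • A.ray i (c i) := by
        funext j
        have : (v j : ℝ) = ε * v i * A.ray i (c i) j := by
          rw [hx j]
          linear_combination -(v j : ℝ) * hε2 + (ε * v j : ℝ) * hεi
        rw [Pi.smul_apply, smul_eq_mul]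
        exact_mod_cast this
      refine ⟨i, c i, ?_⟩
      rcases Int.isUnit_iff.mp (hv _ _ hv') with h2 | h2
      · rw [hv', h2, one_smul]
      · exfalso
        have h3 : (ε : ℝ) * v i = -1 := by exact_mod_cast h2
        have : μ * ((ε : ℝ) * v i) = 1 := by
          rw [← hε2]; linear_combination -(ε : ℝ) * hεi
        rw [h3] at this
        linarith
  · rintro ⟨i, δ, rfl⟩
    exact ⟨A.isPrimitiveVector_ray i δ, A.latticeCone_ray_mem_fan i δ⟩

theorem latticeCone_notMem_fan {n : ℕ} (A : BottMatrix n) {R : Set (Fin n → ℤ)} {i : Fin n}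
    (h0 : A.ray i 0 ∈ R) (h1 : A.ray i 1 ∈ R) : latticeCone R ∉ A.fan := by
  rintro ⟨S, c, hS⟩
  have e0 := mem_latticeCone_of_mem h0
  have e1 := mem_latticeCone_of_mem h1
  rw [hS] at e0 e1
  have := (A.of_ray_mem_latticeCone e0).2.symm.trans (A.of_ray_mem_latticeCone e1).2
  exact absurd this (by decide)

/-- The primitive collections of the fan of a Bott manifold. -/
theorem primitiveCollections_fan {n : ℕ} (A : BottMatrix n) :
    primitiveCollections A.fan = Set.range fun i => {A.ray i 0, A.ray i 1} := by
  classical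
  have hδ : ∀ ε : Fin 2, ε = 0 ∨ ε = 1 := by decide
  ext R
  constructor
  · rintro ⟨-, hR, hRF, hRx⟩
    rw [fanGenerators_fan] at hR
    by_cases h : ∃ i, A.ray i 0 ∈ R ∧ A.ray i 1 ∈ R
    · obtain ⟨i, h0, h1⟩ := h
      refine ⟨i, Set.Subset.antisymm ?_ fun x hx => ?_⟩
      · rintro x (rfl | rfl)
        · exact h0
        · exact h1
      -- Removing an element outside the pair would leave both members of the pair, which never lie
      -- in one cone of the fan.
      · by_contra hne
        simp only [Set.mem_insert_iff, Set.mem_singleton_iff, not_or] at hne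
        exact A.latticeCone_notMem_fan (R := R \ {x}) ⟨h0, fun h => hne.1 h.symm⟩
          ⟨h1, fun h => hne.2 h.symm⟩ (hRx x hx)
    · exfalso
      push Not at h
      -- A set with no full pair is itself a choice of generators, so it spans a cone of the fan.
      -- The default `1` is correct on the index set, where `A.ray i 0 ∉ R` forces `A.ray i 1 ∈ R`.
      refine hRF ⟨{i | A.ray i 0 ∈ R ∨ A.ray i 1 ∈ R}, fun i => if A.ray i 0 ∈ R then 0 else 1, ?_⟩
      congr 1
      ext x
      constructor
      · intro hx
        obtain ⟨i, δ, rfl⟩ := hR hx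
        rcases hδ δ with rfl | rfl
        · exact ⟨i, Or.inl hx, by simp [hx]⟩
        · exact ⟨i, Or.inr hx, by simp [show A.ray i 0 ∉ R from fun h0 => h i h0 hx]⟩
      · rintro ⟨i, hi, rfl⟩
        by_cases h0 : A.ray i 0 ∈ R
        · simp [h0]
        · simpa [h0] using hi.resolve_left h0
  · rintro ⟨i, rfl⟩
    refine ⟨⟨_, Set.mem_insert _ _⟩, ?_, A.latticeCone_notMem_fan (Set.mem_insert _ _)
      (Set.mem_insert_of_mem _ rfl), ?_⟩
    · rw [fanGenerators_fan]
      rintro x (rfl | rfl)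
      · exact ⟨i, 0, rfl⟩
      · exact ⟨i, 1, rfl⟩
    · rintro x (rfl | rfl)
      · have : ({A.ray i 0, A.ray i 1} : Set (Fin n → ℤ)) \ {A.ray i 0} = {A.ray i 1} :=
          Set.insert_sdiff_self_of_notMem (A.ray_ne i)
        rw [this]
        exact A.latticeCone_ray_mem_fan i 1
      · have : ({A.ray i 0, A.ray i 1} : Set (Fin n → ℤ)) \ {A.ray i 1} = {A.ray i 0} := by
          rw [Set.pair_comm]
          exact Set.insert_sdiff_self_of_notMem (A.ray_ne i).symm
        rw [this]
        exact A.latticeCone_ray_mem_fan i 0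

theorem ray_castSucc_eq_snoc {n : ℕ} {A : BottMatrix (n + 1)}
    (h0 : ∀ i : Fin n, A.a (Fin.last n) i.castSucc = 0) (i : Fin n) (δ : Fin 2) :
    A.ray i.castSucc δ = Fin.snoc (α := fun _ => ℤ) (A.truncate.ray i δ) 0 := by
  funext j
  refine Fin.lastCases ?_ (fun j => ?_) j
  · rw [ray_castSucc_last_eq_zero h0, Fin.snoc_last]
  · rw [ray_truncate, Fin.snoc_castSucc]

theorem image_primitiveCollections {n : ℕ} {A : BottMatrix (n + 1)}
    (h0 : ∀ i : Fin n, A.a (Fin.last n) i.castSucc = 0) :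
    (fun R => (fun v : Fin n → ℤ => Fin.snoc (α := fun _ => ℤ) v 0) '' R) ''
        primitiveCollections A.truncate.fan =
      Set.range (fun i : Fin n => {A.ray i.castSucc 0, A.ray i.castSucc 1}) := by
  rw [primitiveCollections_fan, ← Set.range_comp]
  congr 1
  funext i
  simp only [Function.comp, Set.image_pair, ray_castSucc_eq_snoc h0]

/-- The first rays have last entry 0 and the last rays have only a last entry, so the weights of a
combination separate into two independent systems. -/
theorem mem_latticeCone_split {n : ℕ} {A : BottMatrix (n + 1)}
    (h0 : ∀ i : Fin n, A.a (Fin.last n) i.castSucc = 0) (S : Set (Fin (n + 1)))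
    (c : Fin (n + 1) → Fin 2) (x : Fin (n + 1) → ℝ) :
    x ∈ latticeCone ((fun i => A.ray i (c i)) '' S) ↔
      (fun i : Fin n => x i.castSucc) ∈ latticeCone
        ((fun i => A.truncate.ray i (c i.castSucc)) '' {i | i.castSucc ∈ S}) ∧
      (fun _ : Fin 1 => x (Fin.last n)) ∈ latticeCone
        ((fun i => BottMatrix.one.ray i (c (Fin.last n))) '' {_i : Fin 1 | Fin.last n ∈ S}) := by
  have hone : BottMatrix.one.ray 0 (c (Fin.last n)) 0 =
      A.ray (Fin.last n) (c (Fin.last n)) (Fin.last n) := by rw [ray_diag, ray_diag]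
  simp only [mem_latticeCone_image_iff]
  constructor
  · rintro ⟨w, hw, hw', hx⟩
    refine ⟨⟨fun i => w i.castSucc, fun i => hw _, fun i hi => hw' _ hi, fun j => ?_⟩,
      ⟨fun _ => w (Fin.last n), fun _ => hw _, fun _ hi => hw' _ hi, fun j => ?_⟩⟩
    · rw [hx, Fin.sum_univ_castSucc]
      simp [ray_truncate, ray_last_castSucc]
    · rw [hx, Fin.sum_univ_castSucc, Subsingleton.elim j 0]
      simp [ray_castSucc_last_eq_zero h0, hone]
  · rintro ⟨⟨w, hw, hw', hx⟩, ⟨v, hv, hv', hy⟩⟩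
    refine ⟨Fin.snoc (α := fun _ => ℝ) w (v 0), fun i => ?_, fun i => ?_, fun j => ?_⟩
    · refine Fin.lastCases ?_ (fun i => ?_) i
      · simpa using hv 0
      · simpa using hw i
    · refine Fin.lastCases ?_ (fun i => ?_) i
      · simpa using hv' 0
      · simpa using hw' i
    · rw [Fin.sum_univ_castSucc]
      refine Fin.lastCases ?_ (fun j => ?_) j
      · rw [hy 0]
        simp [ray_castSucc_last_eq_zero h0, hone]
      · rw [hx j]
        simp [ray_truncate, ray_last_castSucc]

theorem fan_eq_fanProd {n : ℕ} {A : BottMatrix (n + 1)}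
    (h0 : ∀ i : Fin n, A.a (Fin.last n) i.castSucc = 0) :
    A.fan = fanProd A.truncate.fan BottMatrix.one.fan := by
  ext τ
  constructor
  · rintro ⟨S, c, rfl⟩
    exact ⟨_, ⟨_, _, rfl⟩, _, ⟨{_i | Fin.last n ∈ S}, fun _ => c (Fin.last n), rfl⟩,
      mem_latticeCone_split h0 S c⟩
  · rintro ⟨_, ⟨S, c, rfl⟩, _, ⟨S', c', rfl⟩, hτ⟩
    refine ⟨{i | Fin.lastCases (motive := fun _ => Prop) (0 ∈ S') (fun i => i ∈ S) i},
      Fin.snoc (α := fun _ => Fin 2) c (c' 0), ?_⟩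
    ext x
    rw [hτ, mem_latticeCone_split h0]
    have h1 : {_i : Fin 1 | (0 : Fin 1) ∈ S'} = S' := by
      ext i
      rw [Subsingleton.elim i 0]
      rfl
    have h2 : (fun i => BottMatrix.one.ray i (c' i)) = fun i => BottMatrix.one.ray i (c' 0) := by
      funext i
      rw [Subsingleton.elim i 0]
    simp only [Fin.snoc_castSucc, Fin.snoc_last, Set.mem_ofPred_eq, Fin.lastCases_castSucc,
      Fin.lastCases_last, Set.ofPred_mem_eq, h1, h2]

end BottMatrix

end

/-! ### The splitting of the complex manifold. -/

noncomputable section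

namespace BottMatrix

variable {n : ℕ} (A : BottMatrix (n + 1))

/-- The first `n` pairs of coordinates of a point of `(ℂ² \ {0})ⁿ⁺¹`. -/
def coverFst (p : BottCover A) : BottCover A.truncate :=
  ⟨fun i => p.1 i.castSucc, fun i => p.2 i.castSucc⟩

/-- The last pair of coordinates of a point of `(ℂ² \ {0})ⁿ⁺¹`. -/
def coverSnd (p : BottCover A) : BottCover BottMatrix.one :=
  ⟨fun _ => p.1 (Fin.last n), fun _ => p.2 (Fin.last n)⟩

/-- The point of `(ℂ² \ {0})ⁿ⁺¹` with given first `n` pairs and last pair of coordinates. -/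
def coverJoin (p : BottCover A.truncate) (q : BottCover BottMatrix.one) : BottCover A :=
  ⟨Fin.snoc (α := fun _ => Fin 2 → ℂ) p.1 (q.1 0), fun i =>
    Fin.lastCases (by simpa using q.2 0) (fun i => by simpa using p.2 i) i⟩

theorem coverFst_coverJoin (p : BottCover A.truncate) (q : BottCover BottMatrix.one) :
    A.coverFst (A.coverJoin p q) = p :=
  Subtype.ext (by funext i; simp [coverFst, coverJoin])

theorem coverSnd_coverJoin (p : BottCover A.truncate) (q : BottCover BottMatrix.one) :
    A.coverSnd (A.coverJoin p q) = q :=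
  Subtype.ext (by funext i; rw [Subsingleton.elim i 0]; simp [coverSnd, coverJoin])

theorem coverJoin_coverFst_coverSnd (p : BottCover A) :
    A.coverJoin (A.coverFst p) (A.coverSnd p) = p :=
  Subtype.ext (Fin.snoc_init_self (α := fun _ => Fin 2 → ℂ) p.1)

/-- The last torus factor acts trivially on the earlier coordinates by triangularity alone, so the
projection to the previous stage exists for every Bott matrix. -/
theorem character_castSucc (t : Fin (n + 1) → ℂˣ) (i : Fin n) (δ : Fin 2) :
    A.character t i.castSucc δ = A.truncate.character (fun i => t i.castSucc) i δ := by
  have hl : A.weight i.castSucc δ (Fin.last n) = 0 := by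
    rw [weight]
    split_ifs
    · exact Matrix.one_apply_ne (Fin.castSucc_lt_last i).ne
    · exact A.upper _ _ (Fin.castSucc_lt_last i)
  have hw : ∀ k : Fin n, A.weight i.castSucc δ k.castSucc = A.truncate.weight i δ k := fun k => by
    simp [weight, truncate, Matrix.one_apply]
  simp [character, Fin.prod_univ_castSucc, hl, hw]

/-- Here the trivial last row is needed: its entries are the exponents with which the earlier torus
factors act on the last coordinate w. -/
theorem character_last {A : BottMatrix (n + 1)}
    (h0 : ∀ i : Fin n, A.a (Fin.last n) i.castSucc = 0) (t : Fin (n + 1) → ℂˣ) (i : Fin 1)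
    (δ : Fin 2) : A.character t (Fin.last n) δ =
      BottMatrix.one.character (fun _ => t (Fin.last n)) i δ := by
  have hl : A.weight (Fin.last n) δ (Fin.last n) = 1 := by
    simp [weight, A.diag]
  have hl' : BottMatrix.one.weight i δ 0 = 1 := by
    rw [Subsingleton.elim i 0]
    simp [weight, BottMatrix.one.diag]
  have hw : ∀ k : Fin n, A.weight (Fin.last n) δ k.castSucc = 0 := fun k => by
    rw [weight]
    split_ifs
    · exact Matrix.one_apply_ne (Fin.castSucc_lt_last k).ne'
    · exact h0 k
  simp [character, Fin.prod_univ_castSucc, hl, hw, hl']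

set_option synthInstance.maxHeartbeats 400000 in
theorem coverFst_smul (t : Fin (n + 1) → ℂˣ) (p : BottCover A) :
    A.coverFst (t • p : BottCover A) =
      (fun i : Fin n => t i.castSucc) • A.coverFst p :=
  Subtype.ext (by
    funext i δ
    change (A.character t i.castSucc δ : ℂ) * _ = (A.truncate.character _ i δ : ℂ) * _
    rw [character_castSucc]
    rfl)

set_option synthInstance.maxHeartbeats 400000 in
theorem coverSnd_smul {A : BottMatrix (n + 1)}
    (h0 : ∀ i : Fin n, A.a (Fin.last n) i.castSucc = 0) (t : Fin (n + 1) → ℂˣ)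
    (p : BottCover A) : A.coverSnd (t • p : BottCover A) =
      (fun _ : Fin 1 => t (Fin.last n)) • A.coverSnd p :=
  Subtype.ext (by
    funext i δ
    change (A.character t (Fin.last n) δ : ℂ) * _ = (BottMatrix.one.character _ i δ : ℂ) * _
    rw [character_last h0 t i]
    rfl)

theorem coverJoin_smul {A : BottMatrix (n + 1)}
    (h0 : ∀ i : Fin n, A.a (Fin.last n) i.castSucc = 0) (t : Fin n → ℂˣ) (u : Fin 1 → ℂˣ)
    (p : BottCover A.truncate) (q : BottCover BottMatrix.one) :
    A.coverJoin (t • p) (u • q) =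
      (Fin.snoc (α := fun _ => ℂˣ) t (u 0) : Fin (n + 1) → ℂˣ) • A.coverJoin p q := by
  have hu : (fun _ => u 0) = u := funext fun i => by rw [Subsingleton.elim i 0]
  rw [← A.coverJoin_coverFst_coverSnd ((Fin.snoc (α := fun _ => ℂˣ) t (u 0) : Fin (n + 1) → ℂˣ) • A.coverJoin p q), coverFst_smul, coverSnd_smul h0,
    coverFst_coverJoin, coverSnd_coverJoin]
  simp only [Fin.snoc_castSucc, Fin.snoc_last, hu]

theorem proj_eq_of_smul {m : ℕ} (B : BottMatrix m) {p q : BottCover B}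
    (h : MulAction.orbitRel (Fin m → ℂˣ) (BottCover B) p q) : ∃ t : Fin m → ℂˣ, t • q = p :=
  MulAction.orbitRel_apply.mp h

/-- The projection of a Bott manifold to the previous stage. -/
def quotFst : BottManifold A → BottManifold A.truncate :=
  Quotient.lift (fun p : BottCover A => A.truncate.proj (A.coverFst p)) (by
    intro p q h
    obtain ⟨t, rfl⟩ := A.proj_eq_of_smul h
    rw [coverFst_smul, proj_smul])

/-- The projection of a split Bott manifold to the projective line. -/
def quotSnd {A : BottMatrix (n + 1)} (h0 : ∀ i : Fin n, A.a (Fin.last n) i.castSucc = 0) :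
    BottManifold A → ProjectiveLine :=
  Quotient.lift (fun p : BottCover A => BottMatrix.one.proj (A.coverSnd p)) (by
    intro p q h
    obtain ⟨t, rfl⟩ := A.proj_eq_of_smul h
    rw [coverSnd_smul h0, proj_smul])

/-- The map from the product to a split Bott manifold. -/
def quotJoin {A : BottMatrix (n + 1)} (h0 : ∀ i : Fin n, A.a (Fin.last n) i.castSucc = 0) :
    BottManifold A.truncate → ProjectiveLine → BottManifold A :=
  Quotient.lift₂ (fun p q => A.proj (A.coverJoin p q)) (by
    intro p q p' q' h h'
    obtain ⟨t, rfl⟩ := A.truncate.proj_eq_of_smul h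
    obtain ⟨u, rfl⟩ := BottMatrix.one.proj_eq_of_smul h'
    rw [coverJoin_smul h0, proj_smul])

theorem chart_mem_maximalAtlas {m : ℕ} (B : BottMatrix m) (c : Fin m → Fin 2) :
    B.chart c ∈ IsManifold.maximalAtlas 𝓘(ℂ, Fin m → ℂ) ω (BottManifold B) :=
  IsManifold.subset_maximalAtlas ⟨c, rfl⟩

theorem contMDiff_chart_symm {m : ℕ} (B : BottMatrix m) (c : Fin m → Fin 2) :
    ContMDiff 𝓘(ℂ, Fin m → ℂ) 𝓘(ℂ, Fin m → ℂ) ω (B.chart c).symm :=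
  contMDiffOn_univ.mp (contMDiffOn_symm_of_mem_maximalAtlas (B.chart_mem_maximalAtlas c))

theorem contMDiffOn_chart {m : ℕ} (B : BottMatrix m) (c : Fin m → Fin 2) :
    ContMDiffOn 𝓘(ℂ, Fin m → ℂ) 𝓘(ℂ, Fin m → ℂ) ω (B.chart c) (B.chart c).source :=
  contMDiffOn_of_mem_maximalAtlas (B.chart_mem_maximalAtlas c)

/-- Normalised points project to normalised points, so in the chart of `c` and the chart of its
restriction the map is a coordinate projection. -/
theorem contMDiff_quotFst :
    ContMDiff 𝓘(ℂ, Fin (n + 1) → ℂ) 𝓘(ℂ, Fin n → ℂ) ω A.quotFst := by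
  intro x
  obtain ⟨c, hc⟩ := A.exists_mem_chart_source x
  refine ContMDiffOn.contMDiffAt ?_ ((A.chart c).open_source.mem_nhds hc)
  have hr : ContMDiff 𝓘(ℂ, Fin (n + 1) → ℂ) 𝓘(ℂ, Fin n → ℂ) ω
      fun x : Fin (n + 1) → ℂ => fun i : Fin n => x i.castSucc :=
    contMDiff_iff_contDiff.mpr (contDiff_pi.mpr fun i => contDiff_apply ℂ ℂ i.castSucc)
  refine (((A.truncate.contMDiff_chart_symm fun i => c i.castSucc).comp hr).comp_contMDiffOn
    (A.contMDiffOn_chart c)).congr fun y hy => ?_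
  rw [← (A.chart c).left_inv hy]
  simp only [Function.comp, (A.chart c).right_inv (Set.mem_univ _)]
  rfl

theorem contMDiff_quotSnd {A : BottMatrix (n + 1)}
    (h0 : ∀ i : Fin n, A.a (Fin.last n) i.castSucc = 0) :
    ContMDiff 𝓘(ℂ, Fin (n + 1) → ℂ) 𝓘(ℂ, Fin 1 → ℂ) ω (quotSnd h0) := by
  intro x
  obtain ⟨c, hc⟩ := A.exists_mem_chart_source x
  refine ContMDiffOn.contMDiffAt ?_ ((A.chart c).open_source.mem_nhds hc)
  have hr : ContMDiff 𝓘(ℂ, Fin (n + 1) → ℂ) 𝓘(ℂ, Fin 1 → ℂ) ω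
      fun x : Fin (n + 1) → ℂ => fun _ : Fin 1 => x (Fin.last n) :=
    contMDiff_iff_contDiff.mpr (contDiff_pi.mpr fun i => contDiff_apply ℂ ℂ (Fin.last n))
  refine (((BottMatrix.one.contMDiff_chart_symm fun _ => c (Fin.last n)).comp hr).comp_contMDiffOn
    (A.contMDiffOn_chart c)).congr fun y hy => ?_
  rw [← (A.chart c).left_inv hy]
  simp only [Function.comp, (A.chart c).right_inv (Set.mem_univ _)]
  rfl

theorem contMDiff_quotJoin {A : BottMatrix (n + 1)}
    (h0 : ∀ i : Fin n, A.a (Fin.last n) i.castSucc = 0) :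
    ContMDiff (𝓘(ℂ, Fin n → ℂ).prod 𝓘(ℂ, Fin 1 → ℂ)) 𝓘(ℂ, Fin (n + 1) → ℂ) ω
      fun p : BottManifold A.truncate × ProjectiveLine => quotJoin h0 p.1 p.2 := by
  rintro ⟨x, y⟩
  obtain ⟨c, hc⟩ := A.truncate.exists_mem_chart_source x
  obtain ⟨d, hd⟩ := BottMatrix.one.exists_mem_chart_source y
  refine ContMDiffOn.contMDiffAt (s := (A.truncate.chart c).source ×ˢ
    (BottMatrix.one.chart d).source) ?_ (prod_mem_nhds
      ((A.truncate.chart c).open_source.mem_nhds hc)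
      ((BottMatrix.one.chart d).open_source.mem_nhds hd))
  have hr : ContMDiff (𝓘(ℂ, Fin n → ℂ).prod 𝓘(ℂ, Fin 1 → ℂ)) 𝓘(ℂ, Fin (n + 1) → ℂ) ω
      fun x : (Fin n → ℂ) × (Fin 1 → ℂ) =>
        (Fin.snoc (α := fun _ => ℂ) x.1 (x.2 0) : Fin (n + 1) → ℂ) := by
    rw [← modelWithCornersSelf_prod, chartedSpaceSelf_prod]
    refine contMDiff_iff_contDiff.mpr (contDiff_pi.mpr fun i => ?_)
    refine Fin.lastCases ?_ (fun i => ?_) i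
    · simp only [Fin.snoc_last]
      fun_prop
    · simp only [Fin.snoc_castSucc]
      fun_prop
  refine (((A.contMDiff_chart_symm (Fin.snoc (α := fun _ => Fin 2) c (d 0))).comp
    hr).comp_contMDiffOn ((A.truncate.contMDiffOn_chart c).prodMap
      (BottMatrix.one.contMDiffOn_chart d))).congr ?_
  rintro ⟨y, z⟩ ⟨hy, hz⟩
  simp only at hy hz ⊢
  rw [← (A.truncate.chart c).left_inv hy, ← (BottMatrix.one.chart d).left_inv hz]
  simp only [Function.comp, Prod.map, (A.truncate.chart c).right_inv (Set.mem_univ _),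
    (BottMatrix.one.chart d).right_inv (Set.mem_univ _)]
  refine congrArg A.proj (Subtype.ext ?_)
  funext i δ
  refine Fin.lastCases ?_ (fun i => ?_) i
  · simp [coverJoin, chartInvFun]
  · simp [coverJoin, chartInvFun]

/-- A Bott manifold whose matrix has trivial last row is the product of the previous stage and the
projective line. -/
def splitDiffeomorph {A : BottMatrix (n + 1)}
    (h0 : ∀ i : Fin n, A.a (Fin.last n) i.castSucc = 0) :
    BottManifold A ≃ₘ^ω⟮𝓘(ℂ, Fin (n + 1) → ℂ), 𝓘(ℂ, Fin n → ℂ).prod 𝓘(ℂ, Fin 1 → ℂ)⟯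
      (BottManifold A.truncate × ProjectiveLine) where
  toFun x := (A.quotFst x, quotSnd h0 x)
  invFun p := quotJoin h0 p.1 p.2
  left_inv x := by
    obtain ⟨p, rfl⟩ := A.isOpenQuotientMap_proj.surjective x
    exact congrArg A.proj (A.coverJoin_coverFst_coverSnd p)
  right_inv := by
    rintro ⟨x, y⟩
    obtain ⟨p, rfl⟩ := A.truncate.isOpenQuotientMap_proj.surjective x
    obtain ⟨q, rfl⟩ := BottMatrix.one.isOpenQuotientMap_proj.surjective y
    exact Prod.ext (congrArg A.truncate.proj (A.coverFst_coverJoin p q))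
      (congrArg BottMatrix.one.proj (A.coverSnd_coverJoin p q))
  contMDiff_toFun := A.contMDiff_quotFst.prodMk (contMDiff_quotSnd h0)
  contMDiff_invFun := contMDiff_quotJoin h0

end BottMatrix

end

theorem corollary4p5 (k : ℕ) (A : BottMatrix (k + 2)) (a : Fin (k + 1) → Fin 2 → ℝ)
    (hK : ∃ s : ℝ, A.IsKahlerClass (slabCoeff a s))
    (hF : ∀ s : ℝ, 0 < s → A.IsKahlerClass (slabCoeff a s) →
      A.futaki (slabCoeff a s) (fun x => x (Fin.last (k + 1))) = 0) :
    -- the moment polytope is a prism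
    (∀ s : ℝ, 0 < s → A.polytope (slabCoeff a s) =
      {x | (fun i : Fin (k + 1) => x i.castSucc) ∈ A.truncate.polytope a ∧
        x (Fin.last (k + 1)) ∈ Set.Icc 0 s}) ∧
    A.truncate.IsKahlerClass a ∧
    -- the Bott manifold splits
    A.fan = fanProd A.truncate.fan BottMatrix.one.fan ∧
    Nonempty (BottManifold A
      ≃ₘ^ω⟮𝓘(ℂ, Fin (k + 2) → ℂ), 𝓘(ℂ, Fin (k + 1) → ℂ).prod 𝓘(ℂ, Fin 1 → ℂ)⟯
      (BottManifold A.truncate × ProjectiveLine)) ∧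
    -- the primitive collections of the fan of `X'`, as collections in `ℤⁿ⁻¹ × 0`
    (fun R => (fun v : Fin (k + 1) → ℤ => Fin.snoc (α := fun _ => ℤ) v 0) '' R) ''
        primitiveCollections A.truncate.fan =
      Set.range (fun i : Fin (k + 1) => {A.ray i.castSucc 0, A.ray i.castSucc 1}) ∧
    -- Futaki invariants
    (∀ s : ℝ, 0 < s → ∀ i : Fin (k + 1),
      A.futaki (slabCoeff a s) (fun x => x i.castSucc) =
        s ^ 2 * A.truncate.futaki a (fun y => y i)) ∧
    ((∀ b, A.IsKahlerClass b → ∀ i, A.futaki b (fun x => x i) = 0) →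
      ∀ b, A.truncate.IsKahlerClass b → ∀ i, A.truncate.futaki b (fun y => y i) = 0) := by
  have h0 := A.last_row_eq_zero a hK hF
  refine ⟨fun s _ => BottMatrix.polytope_slabCoeff_eq h0 a s, ?_, BottMatrix.fan_eq_fanProd h0,
    ⟨BottMatrix.splitDiffeomorph h0⟩, BottMatrix.image_primitiveCollections h0,
    fun s hs i => BottMatrix.futaki_slab_castSucc h0 a hs.le i, fun h b hb i => ?_⟩
  · obtain ⟨s, hs⟩ := hK
    exact ((A.isKahlerClass_slabCoeff_iff a s).mp hs).2.1
  -- Any Kähler class downstairs is completed by an interval of length 1 to a Kähler class upstairs,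
  -- where the factor s² is 1.
  · have h1 := h _ (BottMatrix.isKahlerClass_slabCoeff h0 hb one_pos) i.castSucc
    rwa [BottMatrix.futaki_slab_castSucc h0 b zero_le_one, one_pow, one_mul] at h1
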